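/- Let $\mathbb{T}^\infty$ be the infinite torus with its normalized Haar measure $m_\infty$ (the product of the measures $d\theta/2\pi$), let $\mathbb{D}$ be the open unit disc, and for $s\in\{1,2\}$ let $\mathbb{D}_s^\infty=\{\zeta\in\ell^s:\ |\zeta_n|<1 \text{ for all } n\geq 1\}$, an open subset of the complex Banach space $\ell^s$. A function on $\mathbb{D}_s^\infty$ is holomorphic if it is locally bounded and holomorphic along every complex line. For a function $F$ on $\mathbb{D}_s^\infty$ and $0<r<1$ put $F_{[r]}(w)=F(rw_1,r^2w_2,r^3w_3,\ldots)$, $w\in\mathbb{T}^\infty$, and $F^*(w)=\lim_{r\to1}F_{[r]}(w)$ wherever the limit exists. The Smirnov class $N_*(\mathbb{D}_1^\infty)$ consists of the holomorphic functions $F$ on $\mathbb{D}_1^\infty$ with $\sup_{0<r<1}\int_{\mathbb{T}^\infty}\log^+|F_{[r]}|\,dm_\infty<\infty$ for which the family $\{\log^+|F_{[r]}|\}_{0<r<1}$ is uniformly integrable; it carries the metric $d_0(F,G)=\|F-G\|_0$, where $\|F\|_0=\sup_{0<r<1}\int_{\mathbb{T}^\infty}\log(1+|F_{[r]}|)\,dm_\infty$.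 For $0<p<\infty$, the Hardy space $H^p(\mathbb{D}_2^\infty)$ consists of the holomorphic functions $F$ on $\mathbb{D}_2^\infty$ with $\|F\|_p=\big(\sup_{0<r<1}\int_{\mathbb{T}^\infty}|F_{[r]}|^p\,dm_\infty\big)^{1/p}<\infty$, with the topology given by the distances $\|F-G\|_p$ (the metric is $\|F-G\|_p$ if $p\geq1$ and $\|F-G\|_p^p$ if $p<1$). Let $X$ be $N_*(\mathbb{D}_1^\infty)$ or $H^p(\mathbb{D}_2^\infty)$. A closed linear subspace of $X$ is invariant if it is stable under multiplication by every analytic polynomial in finitely many of the variables $\zeta_1,\zeta_2,\ldots$. A function $F\in X$ is cyclic in $X$ if the smallest closed invariant subspace of $X$ containing $F$ is $X$. A nonzero function $F\in N_*(\mathbb{D}_1^\infty)$ is outer if there is some $\zeta\in\mathbb{D}_1^\infty$ with $$\log|F(\zeta)|=\int_{\mathbb{T}^\infty}\mathbf{P}_\zeta\log|F^*|\,dm_\infty,\qquad \mathbf{P}_\zeta(w)=\prod_{n=1}^\infty\frac{1-|\zeta_n|^2}{|\zeta_n-w_n|^2},$$ where it is understood that $F^*$ exists and is nonzero almost everywhere,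 that $\mathbf{P}_\zeta\log|F^*|$ is integrable, and that $F(\zeta)\neq0$. Then: (1) Every cyclic vector of $N_*(\mathbb{D}_1^\infty)$ is outer. (2) For every $0<p<\infty$ and every cyclic vector $F$ of $H^p(\mathbb{D}_2^\infty)$, the restriction of $F$ to $\mathbb{D}_1^\infty$ belongs to $N_*(\mathbb{D}_1^\infty)$ and is outer. -/

import Mathlib

open MeasureTheory Filter Topology
open scoped ENNReal

noncomputable section

namespace InfinitePolydisc

/-! ### The infinite torus and its Haar measure -/

instance : MeasurableSpace Circle := borel Circle

instance : BorelSpace Circle := ⟨rfl⟩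

/-- The normalized arc length measure `dθ / 2π` on the unit circle. -/
def circleMeasure : Measure Circle :=
  (ENNReal.ofReal (2 * Real.pi))⁻¹ •
    (volume.restrict (Set.Ioc 0 (2 * Real.pi))).map Circle.exp

instance : IsProbabilityMeasure circleMeasure := by
  constructor
  have h : (0 : ℝ) < 2 * Real.pi := by positivity
  rw [circleMeasure, Measure.smul_apply,
    Measure.map_apply Circle.exp.continuous.measurable MeasurableSet.univ]
  simp only [Set.preimage_univ, Measure.restrict_apply_univ, Real.volume_Ioc, sub_zero,
    smul_eq_mul]
  exact ENNReal.inv_mul_cancel (by simpa using h) ENNReal.ofReal_ne_top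

/-- The infinite torus `𝕋^∞`. The coordinate `w n` is the `(n + 1)`-st coordinate of `w`. -/
abbrev Torus : Type := ℕ → Circle

/-- The Haar measure `m_∞` of `𝕋^∞`: the product of the measures `dθ / 2π`. -/
def torusMeasure : Measure Torus := Measure.infinitePi fun _ => circleMeasure

/-! ### The domains `ℓ^s ∩ 𝔻^∞` and holomorphic functions -/

/-- The infinite polydisc `𝔻_s^∞ = ℓ^s ∩ 𝔻^∞`, as a subset of `ℓ^s`. -/
def polydisc (s : ℝ≥0∞) : Set (lp (fun _ : ℕ => ℂ) s) := {ζ | ∀ n, ‖ζ n‖ < 1}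

/-- Holomorphy of a function on a subset `V` (in practice open) of a normed space: `F` is
locally bounded, and it is holomorphic along every complex line. (`Function.extend` only serves
to evaluate `F` at points of the line that lie in `V`; outside `V` its value is not used.) -/
def IsHolomorphic {E : Type*} [NormedAddCommGroup E] [NormedSpace ℂ E] {V : Set E}
    (F : V → ℂ) : Prop :=
  (∀ x : V, ∃ M : ℝ, ∀ᶠ y in 𝓝 x, ‖F y‖ ≤ M) ∧
    ∀ x₀ ∈ V, ∀ x : E,
      DifferentiableOn ℂ (fun z : ℂ => Function.extend Subtype.val F 0 (x₀ + z • x))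
        {z : ℂ | x₀ + z • x ∈ V}

lemma memℓp_dilate (s : ℝ≥0∞) [Fact (1 ≤ s)] (r : Set.Ioo (0 : ℝ) 1) (w : Torus) :
    Memℓp (fun n => (((r : ℝ) : ℂ) ^ (n + 1) * (w n : ℂ))) s := by
  refine Memℓp.of_exponent_ge (q := 1) (memℓp_gen ?_) Fact.out
  have h := (summable_nat_add_iff 1).2 (summable_geometric_of_lt_one r.2.1.le r.2.2)
  simpa [abs_of_pos r.2.1, Circle.norm_coe] using h

/-- The point `(r w₁, r² w₂, r³ w₃, …)` of `𝔻_s^∞`, for `0 < r < 1` and `w ∈ 𝕋^∞`. -/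
def dilate (s : ℝ≥0∞) [Fact (1 ≤ s)] (r : Set.Ioo (0 : ℝ) 1) (w : Torus) : polydisc s :=
  ⟨⟨fun n => ((r : ℝ) : ℂ) ^ (n + 1) * (w n : ℂ), memℓp_dilate s r w⟩, fun n => by
    have h : |(r : ℝ)| ^ (n + 1) < 1 := by
      rw [abs_of_pos r.2.1]
      exact pow_lt_one₀ r.2.1.le r.2.2 (Nat.succ_ne_zero n)
    simpa [Circle.norm_coe] using h⟩

/-- The function `F_[r]` on `𝕋^∞`, `F_[r](w) = F(r w₁, r² w₂, r³ w₃, …)`. -/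
def dilation {s : ℝ≥0∞} [Fact (1 ≤ s)] (F : polydisc s → ℂ) (r : Set.Ioo (0 : ℝ) 1)
    (w : Torus) : ℂ :=
  F (dilate s r w)

/-- The filter `r → 1` on the interval `(0, 1)`. -/
def toOne : Filter (Set.Ioo (0 : ℝ) 1) := comap Subtype.val (𝓝[<] (1 : ℝ))

/-- The boundary function `F^*(w) = lim_{r → 1} F_[r](w)` (an arbitrary value where the limit does
not exist). -/
def boundary {s : ℝ≥0∞} [Fact (1 ≤ s)] (F : polydisc s → ℂ) (w : Torus) : ℂ :=
  limUnder toOne fun r => dilation F r w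

/-! ### Closed invariant subspaces and cyclic vectors -/

/-- The polynomials in `𝒫_∞`, analytic and in finitely many variables, as functions on
`𝔻_s^∞`. -/
def polyFun (s : ℝ≥0∞) (q : MvPolynomial ℕ ℂ) (ζ : polydisc s) : ℂ :=
  MvPolynomial.eval (fun n => (ζ : lp (fun _ : ℕ => ℂ) s) n) q

/-- `S` is a closed invariant subspace of the function space `X`, whose metric topology is
given by the distance `N (F - G)`: a linear subspace contained in `X`, closed in `X`, and stable
under multiplication by polynomials. -/
structure IsClosedInvariant {s : ℝ≥0∞} (X : Set (polydisc s → ℂ))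
    (N : (polydisc s → ℂ) → ℝ≥0∞) (S : Submodule ℂ (polydisc s → ℂ)) : Prop where
  subset : (S : Set (polydisc s → ℂ)) ⊆ X
  closed : ∀ G ∈ X, (∀ ε : ℝ≥0∞, 0 < ε → ∃ H ∈ S, N (G - H) < ε) → G ∈ S
  invariant : ∀ q : MvPolynomial ℕ ℂ, ∀ G ∈ S, polyFun s q * G ∈ S

/-- `F ∈ X` is cyclic in `X`: the closed invariant subspace generated by `F` (the intersection
of all closed invariant subspaces containing `F`) is exactly `X`. -/
def IsCyclicIn {s : ℝ≥0∞} (X : Set (polydisc s → ℂ)) (N : (polydisc s → ℂ) → ℝ≥0∞)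
    (F : polydisc s → ℂ) : Prop :=
  F ∈ X ∧ ∀ S : Submodule ℂ (polydisc s → ℂ),
    IsClosedInvariant X N S → F ∈ S → (S : Set (polydisc s → ℂ)) = X

/-! ### The Nevanlinna, Smirnov and Hardy classes -/

/-- The Nevanlinna class `N(𝔻_1^∞)`. -/
def nevanlinnaClass : Set (polydisc 1 → ℂ) :=
  {F | IsHolomorphic F ∧
    ⨆ r, ∫⁻ w, ENNReal.ofReal (Real.posLog ‖dilation F r w‖) ∂torusMeasure < ∞}

/-- The Smirnov class `N_*(𝔻_1^∞)`: the functions of the Nevanlinna class for which the family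
`log⁺ |F_[r]|`, `0 < r < 1`, is uniformly integrable. -/
def smirnovClass : Set (polydisc 1 → ℂ) :=
  {F | F ∈ nevanlinnaClass ∧
    UniformIntegrable (fun r w => Real.posLog ‖dilation F r w‖) 1 torusMeasure}

/-- `‖F‖_0 = sup_{0<r<1} ∫ log (1 + |F_[r]|) dm_∞`, which gives the metric `‖F - G‖_0` of
`N(𝔻_1^∞)` and `N_*(𝔻_1^∞)`. -/
def nevanlinnaNorm (F : polydisc 1 → ℂ) : ℝ≥0∞ :=
  ⨆ r, ∫⁻ w, ENNReal.ofReal (Real.log (1 + ‖dilation F r w‖)) ∂torusMeasure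

/-- `‖F‖_p = (sup_{0<r<1} ∫ |F_[r]|^p dm_∞)^{1/p}`. For `p < 1` the metric is `‖F - G‖_p^p`, which
has the same open and closed sets as `‖F - G‖_p`. -/
def hardyNorm (p : ℝ) (F : polydisc 2 → ℂ) : ℝ≥0∞ :=
  (⨆ r, ∫⁻ w, ‖dilation F r w‖ₑ ^ p ∂torusMeasure) ^ (1 / p)

/-- The Hardy space `H^p(𝔻_2^∞)`. -/
def hardySpace (p : ℝ) : Set (polydisc 2 → ℂ) :=
  {F | IsHolomorphic F ∧ hardyNorm p F < ∞}

/-! ### Outer functions -/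

/-- The Poisson kernel `𝐏_ζ(w) = ∏ₙ (1 - |ζₙ|²) / |ζₙ - wₙ|²` for `ζ ∈ 𝔻_1^∞`, `w ∈ 𝕋^∞`; the
product converges absolutely. -/
def torusPoissonKernel (ζ : polydisc 1) (w : Torus) : ℝ :=
  ∏' n, (1 - ‖(ζ : lp (fun _ : ℕ => ℂ) 1) n‖ ^ 2) /
    ‖(ζ : lp (fun _ : ℕ => ℂ) 1) n - (w n : ℂ)‖ ^ 2

/-- Outer functions: nonzero functions `F ∈ N_*(𝔻_1^∞)` with
`log |F(ζ)| = ∫ 𝐏_ζ log |F^*| dm_∞` for some `ζ ∈ 𝔻_1^∞`. That the equality is meaningful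
(the limits `F^*` exist and are nonzero almost everywhere, the integrand is integrable, and
`log |F(ζ)| ≠ -∞`) is part of the definition. -/
def IsOuter (F : polydisc 1 → ℂ) : Prop :=
  F ∈ smirnovClass ∧ F ≠ 0 ∧
    (∀ᵐ w ∂torusMeasure, Tendsto (fun r => dilation F r w) toOne (𝓝 (boundary F w)) ∧
      boundary F w ≠ 0) ∧
    ∃ ζ : polydisc 1, F ζ ≠ 0 ∧
      Integrable (fun w => torusPoissonKernel ζ w * Real.log ‖boundary F w‖) torusMeasure ∧
      Real.log ‖F ζ‖ = ∫ w, torusPoissonKernel ζ w * Real.log ‖boundary F w‖ ∂torusMeasure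

/-- The inclusion of `𝔻_1^∞` in `𝔻_2^∞`. -/
def incl (ζ : polydisc 1) : polydisc 2 :=
  ⟨⟨fun n => (ζ : lp (fun _ : ℕ => ℂ) 1) n, (lp.memℓp (ζ : lp (fun _ : ℕ => ℂ) 1)).of_exponent_ge
    one_le_two⟩, fun n => ζ.2 n⟩

end InfinitePolydisc

end

noncomputable section

namespace InfinitePolydisc

/-! Cyclicity of F supplies polynomials q_n with ‖1 - q_n F‖_0 ≤ 4^{-(n+1)}
(`exists_lt_of_isCyclicIn`). These approximate inverses give the boundary values of F as well as the
outer identity, which is checked at ζ = 0, where the Poisson kernel is 1.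

Boundary values: the radial maximal function of log(1+|G|) obeys a weak type inequality with bound a
constant times ‖G‖_0 (`IsHolomorphic.measure_radial_mul_le`). Indeed G is holomorphic in one
variable along z ↦ (z w₁, z² w₂, …), where log(1+|G|) lies below its Poisson integral and a covering
argument applies; averaging over rotations carries the estimate to the torus. Applied to 1 - q_n F
with Borel–Cantelli, it shows that for almost every w, q_n F → 1 along the radius uniformly in r.
Each q_n has radial limits, nonzero almost everywhere, so F^* must exist and be nonzero
(`exists_tendsto_of_approx_inverse`). No Fatou theorem for F is needed.

Equality: uniform integrability of log⁺|F_[r]| gives Jensen's inequality log|F(0)| ≤ ∫ log|F^*|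
(`IsHolomorphic.log_norm_zero_le_integral`). Conversely, |x| ≤ 1 + |1 - x| and Fatou's lemma give ∫
log|q_n F^*| ≤ 4^{-(n+1)}, while Jensen for q_n gives ∫ log|q_n| ≥ log|q_n(0)|. Subtracting, ∫
log|F^*| ≤ 4^{-(n+1)} - log|q_n(0)|, and q_n(0) F(0) → 1.

For H^p, restriction to 𝔻_1^∞ lands in the Smirnov class and is continuous at 0 for the two norms,
so the approximation of 1 in H^p becomes one in ‖·‖_0 and the same argument applies. -/

/-! ### One complex variable -/

/-- Every real continuous function on the unit circle is a uniform limit of real parts of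
polynomials. -/
lemma exists_polynomial_re_near {v : ℝ → ℝ} (hv : Continuous v)
    (hper : Function.Periodic v (2 * Real.pi)) {ε : ℝ} (hε : 0 < ε) :
    ∃ p : Polynomial ℂ, ∀ θ : ℝ, |v θ - (p.eval (Complex.exp (θ * Complex.I))).re| < ε := by
  have : Fact (0 < 2 * Real.pi) := ⟨Real.two_pi_pos⟩
  let f : C(AddCircle (2 * Real.pi), ℂ) :=
    ⟨fun x => ((hper.lift x : ℝ) : ℂ),
      Complex.continuous_ofReal.comp (continuous_quot_lift _ hv)⟩
  have hf (θ : ℝ) : f (θ : AddCircle (2 * Real.pi)) = ((v θ : ℝ) : ℂ) := by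
    simp [f]
  have hmem : f ∈ (Submodule.span ℂ (Set.range (fourier (T := 2 * Real.pi)))).topologicalClosure := by
    rw [span_fourier_closure_eq_top]; trivial
  obtain ⟨g, hg, hgf⟩ := Metric.mem_closure_iff.1 hmem ε hε
  -- The factor a is needed for the induction: taking real parts commutes only with real scalars, so
  -- complex ones are absorbed into a first.
  have key : ∀ g ∈ Submodule.span ℂ (Set.range (fourier (T := 2 * Real.pi))), ∀ a : ℂ,
      ∃ p : Polynomial ℂ, ∀ θ : ℝ, (a * g (θ : AddCircle (2 * Real.pi))).re =
        (p.eval (Complex.exp (θ * Complex.I))).re := by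
    intro g hg
    induction hg using Submodule.span_induction with
    | mem x h =>
      obtain ⟨k, rfl⟩ := h
      intro a
      have hk (θ : ℝ) : fourier k (θ : AddCircle (2 * Real.pi)) =
          Complex.exp (θ * Complex.I) ^ k := by
        rw [fourier_coe_apply, ← Complex.exp_int_mul]
        congr 1
        have : (Real.pi : ℂ) ≠ 0 := by exact_mod_cast Real.pi_ne_zero
        push_cast
        field_simp
      rcases Int.eq_nat_or_neg k with ⟨n, rfl | rfl⟩
      · exact ⟨Polynomial.C a * Polynomial.X ^ n, fun θ => by simp [hk]⟩
      -- Negative frequencies are removed by conjugation: on the circle Re(a z⁻ⁿ) = Re(ā zⁿ).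
      · refine ⟨Polynomial.C (starRingEnd ℂ a) * Polynomial.X ^ n, fun θ => ?_⟩
        rw [hk, ← Complex.conj_re]
        simp [← Complex.exp_conj, Complex.exp_neg]
    | zero => exact fun a => ⟨0, by simp⟩
    | add x y _ _ hx hy =>
      intro a
      obtain ⟨p, hp⟩ := hx a
      obtain ⟨q, hq⟩ := hy a
      exact ⟨p + q, fun θ => by
        rw [ContinuousMap.add_apply, mul_add, Complex.add_re, hp, hq, Polynomial.eval_add,
          Complex.add_re]⟩
    | smul c x _ hx =>
      intro a
      obtain ⟨p, hp⟩ := hx (a * c)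
      exact ⟨p, fun θ => by
        rw [ContinuousMap.smul_apply, smul_eq_mul, ← mul_assoc, hp]⟩
  obtain ⟨p, hp⟩ := key g hg 1
  refine ⟨p, fun θ => ?_⟩
  rw [← hp, one_mul]
  calc |v θ - (g (θ : AddCircle (2 * Real.pi))).re|
      = |(f (θ : AddCircle (2 * Real.pi)) - g (θ : AddCircle (2 * Real.pi))).re| := by
        rw [Complex.sub_re, hf, Complex.ofReal_re]
    _ ≤ ‖(f - g) (θ : AddCircle (2 * Real.pi))‖ := by
        simpa using Complex.abs_re_le_norm (f (θ : AddCircle (2 * Real.pi)) - g θ)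
    _ ≤ ‖f - g‖ := ContinuousMap.norm_coe_le_norm _ _
    _ < ε := by rwa [← dist_eq_norm]

lemma poissonKernel_nonneg {R : ℝ} {z w : ℂ} (hz : ‖z‖ ≤ R) (hw : ‖w‖ = R) :
    0 ≤ poissonKernel 0 z w := by
  rw [poissonKernel_def]
  simp only [sub_zero]
  have : ‖z‖ ^ 2 ≤ ‖w‖ ^ 2 := by rw [hw]; gcongr
  apply div_nonneg (by linarith) (by positivity)

lemma continuousOn_poissonKernel {R : ℝ} {z : ℂ} (hz : ‖z‖ < R) :
    ContinuousOn (poissonKernel 0 z) (Metric.sphere 0 R) := by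
  simp only [funext (poissonKernel_def 0 z), sub_zero]
  refine ContinuousOn.div (by fun_prop) (by fun_prop) fun w hw => ?_
  have hw' : ‖w‖ = R := by simpa using hw
  have : w ≠ z := by rintro rfl; exact absurd hw' hz.ne
  simpa [sub_eq_zero] using this

/-- Turning the phase of a makes the triangle inequality sharp. Thus log(1+|f|) is attained at a
given point by log|1 + c f|, with 1 + c f holomorphic. -/
lemma exists_norm_one_add_mul_eq (a : ℂ) : ∃ c : ℂ, ‖c‖ = 1 ∧ ‖1 + c * a‖ = 1 + ‖a‖ := by
  rcases eq_or_ne a 0 with rfl | ha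
  · exact ⟨1, by simp⟩
  · have hn : (‖a‖ : ℂ) ≠ 0 := by simpa using ha
    refine ⟨‖a‖ / a, by simp [ha], ?_⟩
    rw [div_mul_cancel₀ _ ha]
    norm_cast
    rw [Real.norm_of_nonneg (by positivity)]

/-- The function `log (1 + |f|)` is dominated by its Poisson integral. -/
lemma log_one_add_norm_le_circleAverage {f : ℂ → ℂ} {R : ℝ}
    (hf : DiffContOnCl ℂ f (Metric.ball 0 R)) {z : ℂ} (hz : z ∈ Metric.ball 0 R) :
    Real.log (1 + ‖f z‖) ≤
      Real.circleAverage (fun w => poissonKernel 0 z w * Real.log (1 + ‖f w‖)) 0 R := by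
  have hR : 0 < R := Metric.pos_of_mem_ball hz
  have hzR : ‖z‖ < R := by simpa using hz
  have hfc : ContinuousOn f (Metric.sphere 0 R) := by
    refine hf.2.mono ?_
    rw [closure_ball 0 hR.ne']
    exact Metric.sphere_subset_closedBall
  have hlog : ContinuousOn (fun w => Real.log (1 + ‖f w‖)) (Metric.sphere 0 R) :=
    ContinuousOn.log (by fun_prop) fun w _ => by positivity
  have hK := continuousOn_poissonKernel hzR
  have hvc : Continuous (fun θ => Real.log (1 + ‖f (circleMap 0 R θ)‖)) :=
    hlog.comp_continuous (continuous_circleMap 0 R) fun θ => circleMap_mem_sphere 0 hR.le θ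
  have hvp : Function.Periodic (fun θ => Real.log (1 + ‖f (circleMap 0 R θ)‖)) (2 * Real.pi) :=
    fun θ => by simp only [periodic_circleMap 0 R θ]
  refine le_of_forall_pos_le_add fun ε hε => ?_
  obtain ⟨p, hp⟩ := exists_polynomial_re_near hvc hvp (half_pos hε)
  have hRc : (R : ℂ) ≠ 0 := by exact_mod_cast hR.ne'
  have hp' : ∀ w ∈ Metric.sphere (0 : ℂ) R,
      |Real.log (1 + ‖f w‖) - (p.eval (w / R)).re| < ε / 2 := by
    intro w hw
    obtain ⟨θ, -, rfl⟩ : ∃ θ ∈ Set.Ioc 0 (2 * Real.pi), circleMap 0 R θ = w := by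
      have := image_circleMap_Ioc 0 R
      rw [abs_of_pos hR] at this
      rw [← this] at hw
      exact hw
    have h := hp θ
    have h2 : circleMap 0 R θ / R = Complex.exp (θ * Complex.I) := by
      rw [circleMap_zero, mul_div_cancel_left₀ _ hRc]
    rwa [h2]
  have hpd : Differentiable ℂ fun w : ℂ => p.eval (w / R) := by fun_prop
  obtain ⟨c, hc, hcz⟩ := exists_norm_one_add_mul_eq (f z)
  -- Maximum principle: Re p + ε/2 dominates log(1+|f|) ≥ log|1 + c f| on the circle, hence
  -- dominates log|1 + c f| inside, and at z this is log(1+|f(z)|).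
  have hmax : ‖(1 + c * f z) * Complex.exp (-(p.eval (z / R)) - (ε / 2 : ℝ))‖ ≤ 1 := by
    refine Complex.norm_le_of_forall_mem_frontier_norm_le
      (f := fun w => (1 + c * f w) * Complex.exp (-(p.eval (w / R)) - (ε / 2 : ℝ)))
      Metric.isBounded_ball ?_ ?_ (subset_closure hz)
    · refine DiffContOnCl.smul (𝕜 := ℂ) (𝕜' := ℂ) ?_ ?_
      · exact (diffContOnCl_const.add (hf.const_smul c))
      · exact Differentiable.diffContOnCl (by fun_prop)
    · intro w hw
      rw [frontier_ball 0 hR.ne'] at hw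
      have h1 := (abs_lt.1 (hp' w hw)).2
      rw [norm_mul, Complex.norm_exp]
      have h2 : ‖1 + c * f w‖ ≤ Real.exp (Real.log (1 + ‖f w‖)) := by
        rw [Real.exp_log (by positivity)]
        calc ‖1 + c * f w‖ ≤ ‖(1 : ℂ)‖ + ‖c * f w‖ := norm_add_le _ _
          _ = _ := by simp [hc]
      calc _ ≤ Real.exp (Real.log (1 + ‖f w‖)) * _ := by gcongr
        _ ≤ 1 := by
          rw [← Real.exp_add, Real.exp_le_one_iff]
          simp only [Complex.sub_re, Complex.neg_re, Complex.ofReal_re]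
          linarith
  have h1 : Real.log (1 + ‖f z‖) ≤ (p.eval (z / R)).re + ε / 2 := by
    rw [norm_mul, hcz, Complex.norm_exp] at hmax
    have := Real.log_le_log (by positivity) hmax
    rw [Real.log_mul (by positivity) (by positivity), Real.log_exp, Real.log_one] at this
    simp only [Complex.sub_re, Complex.neg_re, Complex.ofReal_re] at this
    linarith
  have hKp : ContinuousOn (poissonKernel 0 z • fun w : ℂ => p.eval (w / R))
      (Metric.sphere 0 R) := hK.smul hpd.continuous.continuousOn
  have h2 : (p.eval (z / R)).re =
      Real.circleAverage (fun w : ℂ => poissonKernel 0 z w * (p.eval (w / R)).re) 0 R := by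
    have h := (hpd.diffContOnCl (s := Metric.ball 0 R)).circleAverage_poissonKernel_smul hz
    rw [← h, ← Complex.reCLM_apply, ← Complex.reCLM.circleAverage_comp_comm
      (hKp.circleIntegrable hR.le)]
    congr 1
    ext w
    simp
  have h3 : Real.circleAverage (poissonKernel 0 z) 0 R = 1 := by
    have h := (diffContOnCl_const (c := (1 : ℂ)) (s := Metric.ball 0 R)
      (𝕜 := ℂ)).circleAverage_poissonKernel_smul hz
    have h' := congrArg Complex.reCLM h
    rw [← Complex.reCLM.circleAverage_comp_comm
      ((hK.smul continuousOn_const).circleIntegrable hR.le)] at h'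
    simp only [Complex.reCLM_apply, Complex.one_re] at h'
    rw [← h']
    congr 1
    ext w
    simp
  have i1 : CircleIntegrable (fun w => poissonKernel 0 z w * Real.log (1 + ‖f w‖)) 0 R :=
    (hK.mul hlog).circleIntegrable hR.le
  have i2 : CircleIntegrable ((ε / 2) • poissonKernel 0 z) 0 R :=
    (hK.const_smul (ε / 2)).circleIntegrable hR.le
  -- Back from Re p to log(1+|f|) under the Poisson integral, at the cost of another ε/2 because the
  -- kernel is positive with mean 1.
  have h4 : Real.circleAverage (fun w : ℂ => poissonKernel 0 z w * (p.eval (w / R)).re) 0 R ≤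
      Real.circleAverage ((fun w => poissonKernel 0 z w * Real.log (1 + ‖f w‖)) +
        (ε / 2) • poissonKernel 0 z) 0 R := by
    refine Real.circleAverage_mono ?_ (i1.add i2) fun w hw => ?_
    · exact ContinuousOn.circleIntegrable hR.le
        (hK.mul (Complex.continuous_re.comp hpd.continuous).continuousOn)
    · rw [abs_of_pos hR] at hw
      have h1 := (abs_lt.1 (hp' w hw)).1
      have h2 := poissonKernel_nonneg hzR.le (by simpa using hw)
      simp only [Pi.add_apply, Pi.smul_apply, smul_eq_mul]
      nlinarith
  rw [Real.circleAverage_add i1 i2, Real.circleAverage_smul, h3, smul_eq_mul, mul_one] at h4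
  linarith

/-! ### The radial maximal inequality in one variable -/

/-- A covering inequality of Hardy–Littlewood type. -/
lemma volume_mul_le_of_forall_closedBall {V : ℝ → ℝ≥0∞} {A S : Set ℝ} {M : ℝ≥0∞} {H : ℝ}
    (hA : ∀ θ ∈ A, ∃ h, 0 < h ∧ h ≤ H ∧ Metric.closedBall θ h ⊆ S ∧
      ENNReal.ofReal (2 * h) * M ≤ ∫⁻ t in Metric.closedBall θ h, V t) :
    volume A * M ≤ 4 * ∫⁻ t in S, V t := by
  choose! h h0 hH hsub hM using hA
  -- The Vitali enlargement factor may be any number above 3; the value 4 becomes the constant of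
  -- the inequality.
  obtain ⟨u, huA, hdisj, hcov⟩ :=
    Vitali.exists_disjoint_subfamily_covering_enlargement_closedBall A id h H hH 4 (by norm_num)
  simp only [id] at hdisj hcov
  have hcount : u.Countable := hdisj.countable_of_nonempty_interior fun i hi =>
    ⟨i, Metric.ball_subset_interior_closedBall (Metric.mem_ball_self (h0 i (huA hi)))⟩
  have hAu : A ⊆ ⋃ b ∈ u, Metric.closedBall b (4 * h b) := by
    intro a ha
    obtain ⟨b, hb, hab⟩ := hcov a ha
    exact Set.mem_biUnion hb (hab (Metric.mem_closedBall_self (h0 a ha).le))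
  have := hcount.to_subtype
  calc volume A * M ≤ (∑' b : u, volume (Metric.closedBall (b : ℝ) (4 * h b))) * M := by
        gcongr
        exact (measure_mono hAu).trans (measure_biUnion_le _ hcount _)
    _ = ∑' b : u, 4 * (ENNReal.ofReal (2 * h b) * M) := by
        rw [← ENNReal.tsum_mul_right]
        congr 1
        ext b
        rw [Real.volume_closedBall, show 2 * (4 * h b) = 4 * (2 * h b) by ring,
          ENNReal.ofReal_mul (by norm_num), mul_assoc]
        norm_num
    _ ≤ ∑' b : u, 4 * ∫⁻ t in Metric.closedBall (b : ℝ) (h b), V t := by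
        gcongr with b
        exact hM b (huA b.2)
    _ = 4 * ∫⁻ t in ⋃ b ∈ u, Metric.closedBall (b : ℝ) (h b), V t := by
        rw [ENNReal.tsum_mul_left, lintegral_biUnion hcount
          (fun _ _ => Metric.isClosed_closedBall.measurableSet) hdisj]
    _ ≤ _ := by
        gcongr
        exact Set.iUnion₂_subset fun b hb => hsub b (huA hb)

/-- Radial and angular lower bounds for the denominator of the Poisson kernel. The angular one is
Jordan's inequality for the chord on the outer circle; moving one endpoint radially costs R - r,
which the first bound absorbs, at the price of a factor 2. -/
lemma norm_circleMap_sub_ge {r R θ φ : ℝ} (hr : 0 ≤ r) (hrR : r < R) (h : |φ - θ| ≤ Real.pi) :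
    R - r ≤ ‖circleMap 0 R φ - circleMap 0 r θ‖ ∧
      R * (|φ - θ| / Real.pi) ≤ ‖circleMap 0 R φ - circleMap 0 r θ‖ := by
  have hR : 0 < R := hr.trans_lt hrR
  have hpi := Real.pi_pos
  have h1 : R - r ≤ ‖circleMap 0 R φ - circleMap 0 r θ‖ := by
    have := norm_sub_norm_le (circleMap 0 R φ) (circleMap 0 r θ)
    rwa [norm_circleMap_zero, norm_circleMap_zero, abs_of_pos hR, abs_of_nonneg hr] at this
  refine ⟨h1, ?_⟩
  have h2 : ‖circleMap 0 R φ - circleMap 0 R θ‖ = R * (2 * |Real.sin ((φ - θ) / 2)|) := by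
    have : circleMap 0 R φ - circleMap 0 R θ =
        circleMap 0 R θ * (Complex.exp (Complex.I * ((φ - θ : ℝ) : ℂ)) - 1) := by
      simp only [circleMap_zero]
      rw [mul_sub, mul_one, mul_assoc, ← Complex.exp_add]
      congr 4
      push_cast
      ring
    rw [this, norm_mul, norm_circleMap_zero, Complex.norm_exp_I_mul_ofReal_sub_one, abs_of_pos hR]
    simp
  have h3 := Real.mul_abs_le_abs_sin (x := (φ - θ) / 2) (by
    rw [abs_div, abs_two]; linarith)
  have h4 : ‖circleMap 0 R θ - circleMap 0 r θ‖ = R - r := by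
    have : circleMap 0 R θ - circleMap 0 r θ = circleMap 0 (R - r) θ := by
      simp only [circleMap_zero]; push_cast; ring
    rw [this, norm_circleMap_zero, abs_of_pos (by linarith)]
  have h5 := norm_sub_le_norm_sub_add_norm_sub (circleMap 0 R φ) (circleMap 0 r θ) (circleMap 0 R θ)
  rw [h2, norm_sub_rev (circleMap 0 r θ), h4] at h5
  have h6 : R * (|φ - θ| / Real.pi) * 2 ≤ R * (2 * |Real.sin ((φ - θ) / 2)|) := by
    rw [mul_assoc]
    refine mul_le_mul_of_nonneg_left ?_ hR.le
    rw [abs_div, abs_two] at h3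
    calc |φ - θ| / Real.pi * 2 = 2 * (2 / Real.pi * (|φ - θ| / 2)) := by ring
      _ ≤ _ := by gcongr
  linarith

/-- Domination of the Poisson kernel by a dyadic step function. -/
lemma exists_poissonKernel_le {r R θ φ : ℝ} (hr : 0 ≤ r) (hrR : r < R)
    (h : |φ - θ| ≤ Real.pi) :
    ∃ k : ℕ, 2 ^ k * ((R - r) / R) ≤ 2 ∧ |φ - θ| ≤ Real.pi * (2 ^ k * ((R - r) / R)) ∧
      poissonKernel 0 (circleMap 0 r θ) (circleMap 0 R φ) ≤ 8 / (4 ^ k * ((R - r) / R)) := by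
  have hR : 0 < R := hr.trans_lt hrR
  have hpi := Real.pi_pos
  obtain ⟨hd1, hd2⟩ := norm_circleMap_sub_ge hr hrR h
  set d := ‖circleMap 0 R φ - circleMap 0 r θ‖ with hd
  set η := (R - r) / R with hη
  set s := |φ - θ| / Real.pi with hs
  have hη0 : 0 < η := div_pos (by linarith) hR
  have hη1 : η ≤ 1 := by rw [hη, div_le_one hR]; linarith
  have hs1 : s ≤ 1 := by rw [hs, div_le_one hpi]; exact h
  have hts : |φ - θ| = Real.pi * s := by rw [hs]; field_simp
  have hδ : R - r = R * η := by rw [hη]; field_simp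
  have hd0 : 0 < d := by nlinarith
  -- The numerator is R² - r² = (R - r)(R + r) ≤ 2R(R - r) = 2R²η.
  have hK : poissonKernel 0 (circleMap 0 r θ) (circleMap 0 R φ) ≤ 2 * R ^ 2 * η / d ^ 2 := by
    rw [poissonKernel_def]
    simp only [sub_zero, norm_circleMap_zero, sq_abs]
    rw [← hd]
    gcongr
    nlinarith
  rw [hts]
  rcases le_or_gt s η with hsη | hsη
  · refine ⟨0, by simp only [pow_zero, one_mul]; linarith, ?_, hK.trans ?_⟩
    · simp only [pow_zero, one_mul]; gcongr
    · rw [pow_zero, one_mul, div_le_div_iff₀ (by positivity) hη0]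
      have : (R * η) ^ 2 ≤ d ^ 2 := by rw [← hδ]; gcongr
      nlinarith
  -- Here 2ⁿη ≤ s < 2ⁿ⁺¹η, so the scale k = n + 1 contains φ, and 2ᵏη ≤ 2s ≤ 2.
  · obtain ⟨n, hn1, hn2⟩ := exists_nat_pow_near (x := s / η) (y := 2)
      ((one_le_div hη0).2 hsη.le) one_lt_two
    rw [le_div_iff₀ hη0] at hn1
    rw [div_lt_iff₀ hη0] at hn2
    refine ⟨n + 1, by rw [pow_succ]; linarith, by gcongr, hK.trans ?_⟩
    rw [div_le_div_iff₀ (by positivity) (by positivity)]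
    have h1 : (R * (2 ^ n * η)) ^ 2 ≤ d ^ 2 := by
      gcongr
      exact (mul_le_mul_of_nonneg_left hn1 hR.le).trans hd2
    have h2 : (4 : ℝ) ^ (n + 1) = 4 * (2 ^ n) ^ 2 := by
      rw [pow_succ, ← pow_mul, mul_comm n 2, pow_mul]; norm_num; ring
    rw [h2]
    nlinarith

lemma continuous_log_one_add_norm_circleMap {f : ℂ → ℂ} {R : ℝ} (hR : 0 < R)
    (hf : DiffContOnCl ℂ f (Metric.ball 0 R)) :
    Continuous fun θ => Real.log (1 + ‖f (circleMap 0 R θ)‖) := by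
  have hfc : Continuous fun θ => f (circleMap 0 R θ) := by
    refine hf.2.comp_continuous (continuous_circleMap 0 R) fun θ => ?_
    rw [closure_ball 0 hR.ne']
    exact Metric.sphere_subset_closedBall (circleMap_mem_sphere 0 hR.le θ)
  exact (continuous_const.add hfc.norm).log fun θ =>
    (add_pos_of_pos_of_nonneg one_pos (norm_nonneg _)).ne'

lemma log_one_add_norm_nonneg (a : ℂ) : 0 ≤ Real.log (1 + ‖a‖) :=
  Real.log_nonneg (by linarith [norm_nonneg a])

lemma periodic_comp_circleMap {β : Type*} (g : ℂ → β) (R : ℝ) :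
    Function.Periodic (fun θ => g (circleMap 0 R θ)) (2 * Real.pi) :=
  fun θ => by simp only [periodic_circleMap 0 R θ]

/-- The Poisson domination of `log (1 + |f|)`, as an integral over a period around the argument. -/
lemma ofReal_log_one_add_norm_le_lintegral {f : ℂ → ℂ} {r R : ℝ} (hr : 0 ≤ r) (hrR : r < R)
    (hf : DiffContOnCl ℂ f (Metric.ball 0 R)) (θ : ℝ) :
    ENNReal.ofReal (Real.log (1 + ‖f (circleMap 0 r θ)‖)) ≤
      ENNReal.ofReal (2 * Real.pi)⁻¹ * ∫⁻ φ in Set.Ioc (θ - Real.pi) (θ + Real.pi),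
        ENNReal.ofReal (poissonKernel 0 (circleMap 0 r θ) (circleMap 0 R φ)) *
          ENNReal.ofReal (Real.log (1 + ‖f (circleMap 0 R φ)‖)) := by
  have hR : 0 < R := hr.trans_lt hrR
  have hz : ‖circleMap 0 r θ‖ < R := by rwa [norm_circleMap_zero, abs_of_nonneg hr]
  have hc : Continuous fun φ => poissonKernel 0 (circleMap 0 r θ) (circleMap 0 R φ) *
      Real.log (1 + ‖f (circleMap 0 R φ)‖) :=
    ((continuousOn_poissonKernel hz).comp_continuous (continuous_circleMap 0 R)
      fun φ => circleMap_mem_sphere 0 hR.le φ).mul (continuous_log_one_add_norm_circleMap hR hf)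
  have h := log_one_add_norm_le_circleAverage hf (z := circleMap 0 r θ) (by simpa using hz)
  have hn (φ : ℝ) : 0 ≤ poissonKernel 0 (circleMap 0 r θ) (circleMap 0 R φ) :=
    poissonKernel_nonneg hz.le (by rw [norm_circleMap_zero, abs_of_pos hR])
  refine (ENNReal.ofReal_le_ofReal h).trans_eq ?_
  rw [Real.circleAverage_def, smul_eq_mul, ENNReal.ofReal_mul (by positivity)]
  congr 1
  have h2 := (periodic_comp_circleMap (fun w => poissonKernel 0 (circleMap 0 r θ) w *
    Real.log (1 + ‖f w‖)) R).intervalIntegral_add_eq 0 (θ - Real.pi)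
  rw [zero_add, show θ - Real.pi + 2 * Real.pi = θ + Real.pi by ring] at h2
  rw [h2, intervalIntegral.integral_of_le (by linarith [Real.pi_pos]),
    ofReal_integral_eq_lintegral_ofReal]
  · congr 1 with φ
    rw [ENNReal.ofReal_mul (hn φ)]
  · exact (hc.integrableOn_Icc).mono_set Set.Ioc_subset_Icc_self
  · exact ae_of_all _ fun φ => mul_nonneg (hn φ) (log_one_add_norm_nonneg _)

/-- If all averages of `log (1 + |f|)` over arcs of the circle of radius `R` centred at argument
`θ` are at most `M`, then `log (1 + |f|)` is at most `16 M` on the corresponding radius. -/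
lemma ofReal_log_one_add_norm_le_of_forall_average_le {f : ℂ → ℂ} {r R : ℝ} (hr : 0 ≤ r)
    (hrR : r < R) (hf : DiffContOnCl ℂ f (Metric.ball 0 R)) (θ : ℝ) {M : ℝ≥0∞}
    (hM : ∀ h, 0 < h → h ≤ 2 * Real.pi → ∫⁻ t in Metric.closedBall θ h,
      ENNReal.ofReal (Real.log (1 + ‖f (circleMap 0 R t)‖)) ≤ ENNReal.ofReal (2 * h) * M) :
    ENNReal.ofReal (Real.log (1 + ‖f (circleMap 0 r θ)‖)) ≤ 16 * M := by
  have hR : 0 < R := hr.trans_lt hrR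
  have hpi := Real.pi_pos
  set V : ℝ → ℝ≥0∞ := fun t => ENNReal.ofReal (Real.log (1 + ‖f (circleMap 0 R t)‖)) with hV
  have hVm : Measurable V := (continuous_log_one_add_norm_circleMap hR hf).measurable.ennreal_ofReal
  set η := (R - r) / R with hη
  have hη0 : 0 < η := div_pos (by linarith) hR
  -- Only scales with 2ᵏη ≤ 2 enter the sum, which keeps the radii at most 2π, the range of `hM`.
  have hpt : ∀ φ ∈ Set.Ioc (θ - Real.pi) (θ + Real.pi),
      ENNReal.ofReal (poissonKernel 0 (circleMap 0 r θ) (circleMap 0 R φ)) * V φ ≤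
        ∑' k : {k : ℕ // 2 ^ k * η ≤ 2}, ENNReal.ofReal (8 / (4 ^ (k : ℕ) * η)) *
          (Metric.closedBall θ (Real.pi * (2 ^ (k : ℕ) * η))).indicator V φ := by
    intro φ hφ
    obtain ⟨k, hk1, hk2, hk3⟩ := exists_poissonKernel_le (θ := θ) (φ := φ) hr hrR
      (abs_le.2 ⟨by linarith [hφ.1], by linarith [hφ.2]⟩)
    refine le_trans ?_ (ENNReal.le_tsum ⟨k, hk1⟩)
    rw [Set.indicator_of_mem (by rwa [Metric.mem_closedBall, Real.dist_eq])]
    gcongr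
  refine (ofReal_log_one_add_norm_le_lintegral hr hrR hf θ).trans ?_
  calc _ ≤ ENNReal.ofReal (2 * Real.pi)⁻¹ * ∫⁻ φ, ∑' k : {k : ℕ // 2 ^ k * η ≤ 2},
        ENNReal.ofReal (8 / (4 ^ (k : ℕ) * η)) *
          (Metric.closedBall θ (Real.pi * (2 ^ (k : ℕ) * η))).indicator V φ := by
        refine mul_le_mul' le_rfl ?_
        exact (setLIntegral_mono' measurableSet_Ioc hpt).trans (setLIntegral_le_lintegral _ _)
    _ = ENNReal.ofReal (2 * Real.pi)⁻¹ * ∑' k : {k : ℕ // 2 ^ k * η ≤ 2},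
        ENNReal.ofReal (8 / (4 ^ (k : ℕ) * η)) *
          ∫⁻ φ in Metric.closedBall θ (Real.pi * (2 ^ (k : ℕ) * η)), V φ := by
        have hi (k : ℕ) : Measurable
            ((Metric.closedBall θ (Real.pi * (2 ^ k * η))).indicator V) :=
          hVm.indicator Metric.isClosed_closedBall.measurableSet
        rw [lintegral_tsum fun k : {k : ℕ // 2 ^ k * η ≤ 2} => ((hi k).const_mul _).aemeasurable]
        congr 2 with k
        rw [lintegral_const_mul _ (hi k),
          lintegral_indicator Metric.isClosed_closedBall.measurableSet]
    _ ≤ ENNReal.ofReal (2 * Real.pi)⁻¹ * ∑' k : {k : ℕ // 2 ^ k * η ≤ 2},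
        ENNReal.ofReal (8 / (4 ^ (k : ℕ) * η)) *
          (ENNReal.ofReal (2 * (Real.pi * (2 ^ (k : ℕ) * η))) * M) := by
        gcongr with k
        refine hM _ (by positivity) ?_
        have := mul_le_mul_of_nonneg_left k.2 hpi.le
        linarith
    -- Kernel height 8/(4ᵏη) times arc length 2π·2ᵏη, over 2π, is 8·2⁻ᵏ; the geometric sum yields
    -- 16.
    _ = ∑' k : {k : ℕ // 2 ^ k * η ≤ 2}, 8 * M * (2⁻¹ : ℝ≥0∞) ^ (k : ℕ) := by
        rw [← ENNReal.tsum_mul_left]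
        congr 1 with k
        rw [← mul_assoc, ← mul_assoc, ← ENNReal.ofReal_mul (by positivity),
          ← ENNReal.ofReal_mul (by positivity)]
        have : (2 * Real.pi)⁻¹ * (8 / (4 ^ (k : ℕ) * η)) * (2 * (Real.pi * (2 ^ (k : ℕ) * η))) =
            8 * (2⁻¹) ^ (k : ℕ) := by
          rw [show (4 : ℝ) = 2 * 2 by norm_num, mul_pow, inv_pow]
          field_simp
        rw [this, ENNReal.ofReal_mul (by norm_num), ENNReal.ofReal_pow (by norm_num),
          ENNReal.ofReal_inv_of_pos two_pos]
        norm_num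
        ring
    _ ≤ ∑' k : ℕ, 8 * M * (2⁻¹ : ℝ≥0∞) ^ k :=
        ENNReal.tsum_comp_le_tsum_of_injective Subtype.val_injective
          (fun k : ℕ => 8 * M * (2⁻¹ : ℝ≥0∞) ^ k)
    _ = 16 * M := by
        rw [ENNReal.tsum_mul_left, ENNReal.tsum_geometric, ENNReal.one_sub_inv_two, inv_inv]
        ring

/-- The weak type inequality for the radial maximal function of `log (1 + |f|)`. -/
lemma volume_radial_mul_le {f : ℂ → ℂ} {R : ℝ} (hR : 0 < R)
    (hf : DiffContOnCl ℂ f (Metric.ball 0 R)) (c : ℝ) :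
    volume {θ ∈ Set.Ioc (-Real.pi) Real.pi | ∃ r, 0 ≤ r ∧ r < R ∧
        c < Real.log (1 + ‖f (circleMap 0 r θ)‖)} * ENNReal.ofReal c ≤
      192 * ∫⁻ θ in Set.Ioc (-Real.pi) Real.pi,
        ENNReal.ofReal (Real.log (1 + ‖f (circleMap 0 R θ)‖)) := by
  have hpi := Real.pi_pos
  have hcont := continuous_log_one_add_norm_circleMap hR hf
  -- Intervals of half-length at most 2π centred in (-π, π] stay in [-3π, 3π], which is three
  -- periods. The final constant is 192 = 16 · 4 · 3.
  have h1 := volume_mul_le_of_forall_closedBall (H := 2 * Real.pi)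
    (A := {θ ∈ Set.Ioc (-Real.pi) Real.pi | ∃ r, 0 ≤ r ∧ r < R ∧
        c < Real.log (1 + ‖f (circleMap 0 r θ)‖)}) (S := Set.Icc (-(3 * Real.pi)) (3 * Real.pi))
    (M := ENNReal.ofReal c / 16)
    (V := fun θ => ENNReal.ofReal (Real.log (1 + ‖f (circleMap 0 R θ)‖))) ?_
  · have h2 : ∫⁻ t in Set.Icc (-(3 * Real.pi)) (3 * Real.pi),
        ENNReal.ofReal (Real.log (1 + ‖f (circleMap 0 R t)‖)) =
        3 * ∫⁻ θ in Set.Ioc (-Real.pi) Real.pi,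
          ENNReal.ofReal (Real.log (1 + ‖f (circleMap 0 R θ)‖)) := by
      have key (a b : ℝ) (hab : a ≤ b) : ∫⁻ t in Set.Ioc a b,
          ENNReal.ofReal (Real.log (1 + ‖f (circleMap 0 R t)‖)) =
          ENNReal.ofReal (∫ t in a..b, Real.log (1 + ‖f (circleMap 0 R t)‖)) := by
        rw [intervalIntegral.integral_of_le hab, ofReal_integral_eq_lintegral_ofReal]
        · exact hcont.integrableOn_Icc.mono_set Set.Ioc_subset_Icc_self
        · exact ae_of_all _ fun φ => log_one_add_norm_nonneg _
      rw [setLIntegral_congr Ioc_ae_eq_Icc.symm, key _ _ (by linarith), key _ _ (by linarith)]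
      have hp := periodic_comp_circleMap (fun w => Real.log (1 + ‖f w‖)) R
      have h3 := hp.intervalIntegral_add_zsmul_eq 3 (-(3 * Real.pi))
        (fun a b => hcont.intervalIntegrable a b)
      have h4 := hp.intervalIntegral_add_eq (-(3 * Real.pi)) (-Real.pi)
      rw [show -(3 * Real.pi) + (3 : ℤ) • (2 * Real.pi) = 3 * Real.pi by simp; ring] at h3
      rw [show -Real.pi + 2 * Real.pi = Real.pi by ring] at h4
      rw [h3, h4, zsmul_eq_mul, ENNReal.ofReal_mul (by norm_num)]
      norm_num
    rw [h2] at h1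
    calc _ = 16 * (volume {θ ∈ Set.Ioc (-Real.pi) Real.pi | ∃ r, 0 ≤ r ∧ r < R ∧
        c < Real.log (1 + ‖f (circleMap 0 r θ)‖)} * (ENNReal.ofReal c / 16)) := by
          rw [mul_left_comm, ENNReal.mul_div_cancel (by norm_num) (by norm_num)]
      _ ≤ 16 * (4 * (3 * ∫⁻ θ in Set.Ioc (-Real.pi) Real.pi,
          ENNReal.ofReal (Real.log (1 + ‖f (circleMap 0 R θ)‖)))) := by gcongr
      _ = _ := by ring
  -- If every average about θ were below c/16, the previous lemma would bound the whole radius by c.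
  -- For c ≤ 0 the assumed strict inequality already reads `_ < 0`.
  · rintro θ ⟨hθ, r, hr, hrR, hc⟩
    by_contra! hcon
    have hle : ∀ h, 0 < h → h ≤ 2 * Real.pi → ∫⁻ t in Metric.closedBall θ h,
        ENNReal.ofReal (Real.log (1 + ‖f (circleMap 0 R t)‖)) ≤
          ENNReal.ofReal (2 * h) * (ENNReal.ofReal c / 16) := fun h h0 h1 =>
      (hcon h h0 h1 (by
        rw [Real.closedBall_eq_Icc]
        exact Set.Icc_subset_Icc (by linarith [hθ.1]) (by linarith [hθ.2]))).le
    have h5 := ofReal_log_one_add_norm_le_of_forall_average_le hr hrR hf θ hle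
    rw [ENNReal.mul_div_cancel (by norm_num) (by norm_num)] at h5
    rcases le_or_gt c 0 with hc0 | hc0
    · have h6 := hcon Real.pi hpi (by linarith) (by
        rw [Real.closedBall_eq_Icc]
        exact Set.Icc_subset_Icc (by linarith [hθ.1]) (by linarith [hθ.2]))
      rw [ENNReal.ofReal_of_nonpos hc0] at h6
      simp at h6
    · exact absurd hc (not_lt.2 ((ENNReal.ofReal_le_ofReal_iff hc0.le).1 h5))

/-! ### Holomorphic functions on open sets of normed spaces -/

section Holomorphic

variable {E : Type*} [NormedAddCommGroup E] [NormedSpace ℂ E] {V : Set E} {F G : V → ℂ}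

lemma extend_val_of_mem {α : Type*} {V : Set α} {x : α} (F : V → ℂ) (hx : x ∈ V) :
    Function.extend Subtype.val F 0 x = F ⟨x, hx⟩ :=
  Subtype.val_injective.extend_apply F 0 ⟨x, hx⟩

/-- Schwarz's lemma on the complex line through y and z, where local boundedness bounds F on a disc
of fixed size. This gives continuity of F, and differentiability along curves that are not lines. -/
lemma IsHolomorphic.exists_lipschitz (hV : IsOpen V) (hF : IsHolomorphic F) {x : E} (hx : x ∈ V) :
    ∃ ρ > 0, ∃ L : ℝ, Metric.ball x ρ ⊆ V ∧ ∀ y ∈ Metric.ball x ρ, ∀ z ∈ Metric.ball x ρ,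
      ‖Function.extend Subtype.val F 0 z - Function.extend Subtype.val F 0 y‖ ≤ L * ‖z - y‖ := by
  obtain ⟨M, hM⟩ := hF.1 ⟨x, hx⟩
  have hM' : ∀ᶠ y in 𝓝 x, ‖Function.extend Subtype.val F 0 y‖ ≤ M := by
    rw [nhds_subtype_eq_comap, eventually_comap] at hM
    filter_upwards [hM, hV.mem_nhds hx] with y hy hyV
    rw [extend_val_of_mem F hyV]
    exact hy ⟨y, hyV⟩ rfl
  obtain ⟨ε, hε, hball⟩ := Metric.eventually_nhds_iff_ball.1 (hM'.and (hV.mem_nhds hx))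
  have hM0 : 0 ≤ M := (norm_nonneg _).trans (hball x (Metric.mem_ball_self hε)).1
  refine ⟨ε / 4, by positivity, (2 * M + 1) / (ε / 2),
    fun y hy => (hball y (Metric.ball_subset_ball (by linarith) hy)).2, fun y hy z hz => ?_⟩
  rcases eq_or_ne z y with rfl | hzy
  · simp
  have hu : 0 < ‖z - y‖ := norm_pos_iff.2 (sub_ne_zero.2 hzy)
  rw [mem_ball_iff_norm] at hy hz
  have hu2 : ‖z - y‖ < ε / 2 := by
    have := norm_sub_le_norm_sub_add_norm_sub z x y
    rw [norm_sub_rev x y] at this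
    linarith
  have hmem : ∀ t ∈ Metric.ball (0 : ℂ) (ε / 2 / ‖z - y‖), y + t • (z - y) ∈ Metric.ball x ε := by
    intro t ht
    rw [mem_ball_zero_iff, lt_div_iff₀ hu] at ht
    rw [mem_ball_iff_norm, add_sub_right_comm]
    calc _ ≤ ‖y - x‖ + ‖t • (z - y)‖ := norm_add_le _ _
      _ < ε := by rw [norm_smul]; linarith
  have hd : DifferentiableOn ℂ
      (fun t : ℂ => Function.extend Subtype.val F 0 (y + t • (z - y)))
      (Metric.ball 0 (ε / 2 / ‖z - y‖)) :=
    (hF.2 y (hball y (by rw [mem_ball_iff_norm]; linarith)).2 (z - y)).mono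
      fun t ht => (hball _ (hmem t ht)).2
  -- The oscillation is at most 2M; the extra 1 makes the inequality strict even when M = 0.
  have hmaps : Set.MapsTo (fun t : ℂ => Function.extend Subtype.val F 0 (y + t • (z - y)))
      (Metric.ball 0 (ε / 2 / ‖z - y‖))
      (Metric.ball (Function.extend Subtype.val F 0 (y + (0 : ℂ) • (z - y))) (2 * M + 1)) := by
    intro t ht
    rw [mem_ball_iff_norm]
    refine (norm_sub_le _ _).trans_lt ?_
    have h1 := (hball _ (hmem t ht)).1
    have h2 := (hball _ (hmem 0 (Metric.mem_ball_self (by positivity)))).1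
    linarith
  have h := Complex.dist_le_div_mul_dist_of_mapsTo_ball hd
    (hmaps.mono_right Metric.ball_subset_closedBall) (z := 1)
    (by rw [mem_ball_zero_iff, norm_one, one_lt_div hu]; exact hu2)
  simp only [one_smul, zero_smul, add_zero, add_sub_cancel, dist_eq_norm, sub_zero, norm_one,
    mul_one] at h
  refine h.trans_eq ?_
  field_simp

lemma IsHolomorphic.continuous (hV : IsOpen V) (hF : IsHolomorphic F) : Continuous F := by
  rw [continuous_iff_continuousAt]
  rintro ⟨x, hx⟩
  obtain ⟨ρ, hρ, L, hsub, hL⟩ := hF.exists_lipschitz hV hx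
  rw [ContinuousAt, tendsto_iff_norm_sub_tendsto_zero]
  have hlim : Tendsto (fun y : V => L * ‖(y : E) - x‖) (𝓝 ⟨x, hx⟩) (𝓝 0) := by
    have : Continuous fun y : V => L * ‖(y : E) - x‖ := by fun_prop
    simpa using this.tendsto ⟨x, hx⟩
  refine squeeze_zero' (Eventually.of_forall fun _ => norm_nonneg _) ?_ hlim
  have : ∀ᶠ y : V in 𝓝 ⟨x, hx⟩, (y : E) ∈ Metric.ball x ρ :=
    continuous_subtype_val.continuousAt.eventually (Metric.ball_mem_nhds x hρ)
  filter_upwards [this] with y hy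
  have := hL x (Metric.mem_ball_self hρ) y hy
  rwa [extend_val_of_mem F hx, extend_val_of_mem F y.2] at this

/-- A holomorphic function is complex differentiable along differentiable curves. -/
lemma IsHolomorphic.differentiableAt_comp (hV : IsOpen V) (hF : IsHolomorphic F) {γ : ℂ → E}
    {z₀ : ℂ} (hγ : DifferentiableAt ℂ γ z₀) (hz : γ z₀ ∈ V) :
    DifferentiableAt ℂ (fun z => Function.extend Subtype.val F 0 (γ z)) z₀ := by
  obtain ⟨ρ, hρ, L, hsub, hL⟩ := hF.exists_lipschitz hV hz
  obtain ⟨v, hv⟩ : ∃ v, HasDerivAt γ v z₀ := ⟨_, hγ.hasDerivAt⟩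
  have hline : Continuous fun z : ℂ => γ z₀ + (z - z₀) • v := by fun_prop
  have hdl : DifferentiableAt ℂ
      (fun t : ℂ => Function.extend Subtype.val F 0 (γ z₀ + t • v)) (z₀ - z₀) := by
    refine (hF.2 (γ z₀) hz v).differentiableAt ?_
    refine IsOpen.mem_nhds (hV.preimage (by fun_prop : Continuous fun t : ℂ => γ z₀ + t • v)) ?_
    simpa using hz
  have hl := HasDerivAt.comp_sub_const z₀ z₀ hdl.hasDerivAt
  set D := deriv (fun t : ℂ => Function.extend Subtype.val F 0 (γ z₀ + t • v)) (z₀ - z₀)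
  refine HasDerivAt.differentiableAt (f' := D) ?_
  rw [hasDerivAt_iff_isLittleO] at hl hv ⊢
  -- Replacing the curve by its tangent line moves the argument by o(z - z₀), and the Lipschitz
  -- bound transfers this to F. On the line F is holomorphic by definition.
  have h1 : (fun z => Function.extend Subtype.val F 0 (γ z) -
      Function.extend Subtype.val F 0 (γ z₀ + (z - z₀) • v)) =o[𝓝 z₀] fun z => z - z₀ := by
    refine Asymptotics.IsBigO.trans_isLittleO ?_ hv
    refine Asymptotics.IsBigO.of_bound L ?_
    have e1 : ∀ᶠ z in 𝓝 z₀, γ z ∈ Metric.ball (γ z₀) ρ :=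
      hγ.continuousAt.eventually (Metric.ball_mem_nhds _ hρ)
    have e2 : ∀ᶠ z in 𝓝 z₀, γ z₀ + (z - z₀) • v ∈ Metric.ball (γ z₀) ρ := by
      refine hline.continuousAt.eventually (Metric.isOpen_ball.mem_nhds ?_)
      simpa using hρ
    filter_upwards [e1, e2] with z hz1 hz2
    have := hL _ hz2 _ hz1
    rwa [← sub_sub] at this
  refine (h1.add hl).congr_left fun z => ?_
  simp only [sub_self, zero_smul, add_zero]
  abel

/-- Allows holomorphy along a line to be checked on any convenient formula for F there, rather than
on the extension by zero. -/
lemma IsHolomorphic.of_forall (hb : ∀ x : V, ∃ M : ℝ, ∀ᶠ y in 𝓝 x, ‖F y‖ ≤ M)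
    (hd : ∀ x₀ ∈ V, ∀ x : E, ∃ g : ℂ → ℂ, DifferentiableOn ℂ g {z : ℂ | x₀ + z • x ∈ V} ∧
      ∀ z, ∀ hz : x₀ + z • x ∈ V, F ⟨_, hz⟩ = g z) : IsHolomorphic F := by
  refine ⟨hb, fun x₀ h₀ x => ?_⟩
  obtain ⟨g, hg, hFg⟩ := hd x₀ h₀ x
  exact hg.congr fun z hz => by rw [extend_val_of_mem F hz, hFg z hz]

lemma isHolomorphic_const (c : ℂ) : IsHolomorphic fun _ : V => c :=
  .of_forall (fun _ => ⟨‖c‖, Eventually.of_forall fun _ => le_rfl⟩)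
    fun _ _ _ => ⟨fun _ => c, differentiableOn_const c, fun _ _ => rfl⟩

lemma IsHolomorphic.add (hF : IsHolomorphic F) (hG : IsHolomorphic G) : IsHolomorphic (F + G) := by
  refine .of_forall (fun x => ?_) fun x₀ h₀ x => ⟨_, (hF.2 x₀ h₀ x).add (hG.2 x₀ h₀ x), ?_⟩
  · obtain ⟨M, hM⟩ := hF.1 x
    obtain ⟨N, hN⟩ := hG.1 x
    refine ⟨M + N, ?_⟩
    filter_upwards [hM, hN] with y h1 h2
    exact (norm_add_le _ _).trans (add_le_add h1 h2)
  · intro z hz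
    simp [extend_val_of_mem _ hz]

lemma IsHolomorphic.mul (hF : IsHolomorphic F) (hG : IsHolomorphic G) : IsHolomorphic (F * G) := by
  refine .of_forall (fun x => ?_) fun x₀ h₀ x => ⟨_, (hF.2 x₀ h₀ x).mul (hG.2 x₀ h₀ x), ?_⟩
  · obtain ⟨M, hM⟩ := hF.1 x
    obtain ⟨N, hN⟩ := hG.1 x
    refine ⟨M * N, ?_⟩
    filter_upwards [hM, hN] with y h1 h2
    rw [Pi.mul_apply, norm_mul]
    exact mul_le_mul h1 h2 (norm_nonneg _) ((norm_nonneg _).trans h1)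
  · intro z hz
    simp [extend_val_of_mem _ hz]

lemma IsHolomorphic.const_smul (c : ℂ) (hF : IsHolomorphic F) : IsHolomorphic (c • F) :=
  (isHolomorphic_const c).mul hF

end Holomorphic

/-! ### The infinite polydisc -/

section Polydisc

variable {s : ℝ≥0∞}

lemma zero_mem_polydisc : (0 : lp (fun _ : ℕ => ℂ) s) ∈ polydisc s := fun n => by simp

lemma polyFun_C (c : ℂ) : polyFun s (MvPolynomial.C c) = fun _ => c := by
  ext; simp [polyFun]

lemma polyFun_X (n : ℕ) :
    polyFun s (MvPolynomial.X n) = fun ζ : polydisc s => (ζ : lp (fun _ : ℕ => ℂ) s) n := by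
  ext; simp [polyFun]

lemma polyFun_add (p q : MvPolynomial ℕ ℂ) : polyFun s (p + q) = polyFun s p + polyFun s q := by
  ext; simp [polyFun]

lemma polyFun_mul (p q : MvPolynomial ℕ ℂ) : polyFun s (p * q) = polyFun s p * polyFun s q := by
  ext; simp [polyFun]

lemma polyFun_one : polyFun s 1 = 1 := by
  ext; simp [polyFun]

lemma exists_norm_polyFun_le (q : MvPolynomial ℕ ℂ) :
    ∃ M : ℝ, ∀ ζ : polydisc s, ‖polyFun s q ζ‖ ≤ M := by
  induction q using MvPolynomial.induction_on with
  | C a => exact ⟨‖a‖, fun ζ => by rw [polyFun_C]⟩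
  | add p q hp hq =>
    obtain ⟨M, hM⟩ := hp
    obtain ⟨N, hN⟩ := hq
    refine ⟨M + N, fun ζ => ?_⟩
    rw [polyFun_add]
    exact (norm_add_le _ _).trans (add_le_add (hM ζ) (hN ζ))
  | mul_X p n hp =>
    obtain ⟨M, hM⟩ := hp
    refine ⟨M, fun ζ => ?_⟩
    rw [polyFun_mul, polyFun_X, Pi.mul_apply, norm_mul]
    exact (mul_le_of_le_one_right (norm_nonneg _) (ζ.2 n).le).trans (hM ζ)

variable [Fact (1 ≤ s)]

/-- For s < ∞ the coordinates tend to 0: all but finitely many have modulus below 1/2 and survive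
any perturbation of norm below 1/2, and the others impose finitely many open conditions. -/
lemma isOpen_polydisc (hs : s ≠ ∞) : IsOpen (polydisc s) := by
  have hs0 : s ≠ 0 := (zero_lt_one.trans_le (Fact.out : 1 ≤ s)).ne'
  rw [isOpen_iff_mem_nhds]
  intro ζ hζ
  have hlim : Tendsto (fun n => ‖ζ n‖) cofinite (𝓝 0) := by
    have hpos : 0 < s.toReal := ENNReal.toReal_pos hs0 hs
    have h1 := (lp.memℓp ζ).summable hpos
    have h2 := h1.tendsto_cofinite_zero.rpow_const (p := s.toReal⁻¹) (Or.inr (by positivity))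
    rw [Real.zero_rpow (by positivity)] at h2
    refine h2.congr fun n => ?_
    rw [← Real.rpow_mul (norm_nonneg _), mul_inv_cancel₀ hpos.ne', Real.rpow_one]
  have hfin : {n | ¬ ‖ζ n‖ < 1 / 2}.Finite := hlim.eventually (gt_mem_nhds (by norm_num))
  have h1 : ∀ᶠ ξ in 𝓝 ζ, ∀ n ∈ {n | ¬ ‖ζ n‖ < 1 / 2}, ‖ξ n‖ < 1 := by
    rw [eventually_all_finite hfin]
    intro n _
    have hc : Continuous fun ξ : lp (fun _ : ℕ => ℂ) s => ‖ξ n‖ :=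
      (continuous_apply n |>.comp (lp.uniformContinuous_coe.continuous)).norm
    exact hc.continuousAt.eventually (gt_mem_nhds (hζ n))
  filter_upwards [h1, Metric.ball_mem_nhds ζ (ε := 1 / 2) (by norm_num)] with ξ h2 h3 n
  by_cases hn : ‖ζ n‖ < 1 / 2
  · have h4 := lp.norm_apply_le_norm hs0 (ξ - ζ) n
    rw [mem_ball_iff_norm] at h3
    rw [lp.coeFn_sub, Pi.sub_apply] at h4
    have := norm_le_norm_add_norm_sub' (ξ n) (ζ n)
    linarith
  · exact h2 n hn

lemma isHolomorphic_coord (n : ℕ) :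
    IsHolomorphic fun ζ : polydisc s => (ζ : lp (fun _ : ℕ => ℂ) s) n :=
  .of_forall (fun _ => ⟨1, Eventually.of_forall fun ζ => (ζ.2 n).le⟩)
    fun x₀ _ x => ⟨fun z => x₀ n + z * x n, by fun_prop, fun _ _ => rfl⟩

lemma isHolomorphic_polyFun (q : MvPolynomial ℕ ℂ) : IsHolomorphic (polyFun s q) := by
  induction q using MvPolynomial.induction_on with
  | C a => rw [polyFun_C]; exact isHolomorphic_const a
  | add p q hp hq => rw [polyFun_add]; exact hp.add hq
  | mul_X p n hp => rw [polyFun_mul, polyFun_X]; exact hp.mul (isHolomorphic_coord n)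

/-! ### Curves in the polydisc and one-variable slices -/

/-- The rotation of `𝕋^∞` induced by a rotation of the disc along the curve
`z ↦ (z w₁, z² w₂, …)`. -/
def rotate (θ : ℝ) (w : Torus) : Torus := fun n => Circle.exp ((n + 1) * θ) * w n

variable (s) in
/-- The curve `z ↦ (z w₁, z² w₂, …)` in `ℓ^s`. -/
def curve (w : Torus) (z : ℂ) : lp (fun _ : ℕ => ℂ) s :=
  ∑' n, (z ^ (n + 1) * (w n : ℂ)) • lp.single s n (1 : ℂ)

lemma norm_curve_term (w : Torus) (z : ℂ) (n : ℕ) :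
    ‖(z ^ (n + 1) * (w n : ℂ)) • lp.single (E := fun _ : ℕ => ℂ) s n (1 : ℂ)‖ = ‖z‖ ^ (n + 1) := by
  rw [norm_smul, lp.norm_single (zero_lt_one.trans_le Fact.out)]
  simp [Circle.norm_coe]

lemma summable_pow_succ {ρ : ℝ} (h0 : 0 ≤ ρ) (h1 : ρ < 1) : Summable fun n : ℕ => ρ ^ (n + 1) :=
  (summable_nat_add_iff 1).2 (summable_geometric_of_lt_one h0 h1)

lemma curve_eq_of_forall (hs : s ≠ ∞) {w : Torus} {z : ℂ} {x : lp (fun _ : ℕ => ℂ) s}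
    (hx : ∀ n, x n = z ^ (n + 1) * (w n : ℂ)) : curve s w z = x := by
  have h := lp.hasSum_single hs x
  refine Eq.trans ?_ h.tsum_eq
  refine tsum_congr fun n => ?_
  rw [← lp.single_smul, hx, smul_eq_mul, mul_one]

lemma curve_apply (hs : s ≠ ∞) (w : Torus) {z : ℂ} (hz : ‖z‖ < 1) (n : ℕ) :
    curve s w z n = z ^ (n + 1) * (w n : ℂ) := by
  have hmem : Memℓp (fun n => z ^ (n + 1) * (w n : ℂ)) s := by
    refine Memℓp.of_exponent_ge (q := 1) (memℓp_gen ?_) Fact.out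
    simpa [Circle.norm_coe] using summable_pow_succ (norm_nonneg z) hz
  rw [curve_eq_of_forall hs (x := ⟨_, hmem⟩) fun _ => rfl]

lemma curve_mem (hs : s ≠ ∞) (w : Torus) {z : ℂ} (hz : ‖z‖ < 1) : curve s w z ∈ polydisc s :=
  fun n => by
    rw [curve_apply hs w hz]
    simpa [Circle.norm_coe] using pow_lt_one₀ (norm_nonneg z) hz (Nat.succ_ne_zero n)

lemma curve_zero (w : Torus) : curve s w 0 = 0 := by
  simp [curve]

lemma curve_circleMap (hs : s ≠ ∞) (w : Torus) (r : Set.Ioo (0 : ℝ) 1) (θ : ℝ) :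
    curve s w (circleMap 0 r θ) = dilate s r (rotate θ w) := by
  refine curve_eq_of_forall hs fun n => ?_
  change ((r : ℝ) : ℂ) ^ (n + 1) * (rotate θ w n : ℂ) = _
  rw [rotate, Circle.coe_mul, Circle.coe_exp, circleMap_zero, mul_pow, ← Complex.exp_nat_mul,
    mul_assoc]
  push_cast
  ring_nf

/-- The series converges normally on every disc of radius below 1, so Weierstrass' theorem applies.
-/
lemma differentiableOn_curve (w : Torus) : DifferentiableOn ℂ (curve s w) (Metric.ball 0 1) := by
  intro z hz
  rw [mem_ball_zero_iff] at hz
  obtain ⟨ρ, h1, h2⟩ := exists_between hz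
  have h0 : 0 ≤ ρ := (norm_nonneg z).trans h1.le
  have h : DifferentiableOn ℂ (curve s w) (Metric.ball 0 ρ) := by
    refine Complex.differentiableOn_tsum_of_summable_norm (summable_pow_succ h0 h2)
      (fun n => ?_) Metric.isOpen_ball fun n y hy => ?_
    · exact DifferentiableOn.smul_const (by fun_prop) _
    · rw [norm_curve_term]
      rw [mem_ball_zero_iff] at hy
      gcongr
  exact (h.differentiableAt (Metric.isOpen_ball.mem_nhds (by simpa using h1))).differentiableWithinAt

lemma continuous_dilate (hs : s ≠ ∞) (r : Set.Ioo (0 : ℝ) 1) : Continuous (dilate s r) := by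
  refine Continuous.subtype_mk (f := fun w => (dilate s r w : lp (fun _ : ℕ => ℂ) s)) ?_ _
  have h : (fun w => (dilate s r w : lp (fun _ : ℕ => ℂ) s)) = fun w => curve s w r := by
    ext1 w
    exact (curve_eq_of_forall hs fun _ => rfl).symm
  rw [h]
  refine continuous_tsum (fun n => ?_) (summable_pow_succ r.2.1.le r.2.2) fun n w => ?_
  · have : Continuous fun w : Torus => (w n : ℂ) := by fun_prop
    fun_prop
  · rw [norm_curve_term]
    simp [abs_of_pos r.2.1]

variable {F : polydisc s → ℂ}

lemma IsHolomorphic.continuous_dilation (hs : s ≠ ∞) (hF : IsHolomorphic F)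
    (r : Set.Ioo (0 : ℝ) 1) : Continuous (dilation F r) :=
  (hF.continuous (isOpen_polydisc hs)).comp (continuous_dilate hs r)

/-- The restriction of `F` to the curve `z ↦ (z w₁, z² w₂, …)`. -/
def slice (F : polydisc s → ℂ) (w : Torus) (z : ℂ) : ℂ :=
  Function.extend Subtype.val F 0 (curve s w z)

lemma slice_zero (F : polydisc s → ℂ) (w : Torus) : slice F w 0 = F ⟨0, zero_mem_polydisc⟩ := by
  rw [slice, curve_zero, extend_val_of_mem F zero_mem_polydisc]

/-- The exponents n + 1 in the dilation, the curve and the rotation agree, so circles in a slice are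
rotation orbits. This is the bridge from one variable to the torus. -/
lemma slice_circleMap (hs : s ≠ ∞) (F : polydisc s → ℂ) (w : Torus) (r : Set.Ioo (0 : ℝ) 1)
    (θ : ℝ) : slice F w (circleMap 0 r θ) = dilation F r (rotate θ w) := by
  rw [slice, curve_circleMap hs, extend_val_of_mem F (dilate s r (rotate θ w)).2]
  rfl

lemma IsHolomorphic.differentiableOn_slice (hs : s ≠ ∞) (hF : IsHolomorphic F) (w : Torus) :
    DifferentiableOn ℂ (slice F w) (Metric.ball 0 1) := fun z hz =>
  (hF.differentiableAt_comp (isOpen_polydisc hs)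
    ((differentiableOn_curve w).differentiableAt (Metric.isOpen_ball.mem_nhds hz))
    (curve_mem hs w (by simpa using hz))).differentiableWithinAt

lemma IsHolomorphic.diffContOnCl_slice (hs : s ≠ ∞) (hF : IsHolomorphic F) (w : Torus)
    (r : Set.Ioo (0 : ℝ) 1) : DiffContOnCl ℂ (slice F w) (Metric.ball 0 r) := by
  refine DifferentiableOn.diffContOnCl ((hF.differentiableOn_slice hs w).mono ?_)
  rw [closure_ball 0 r.2.1.ne']
  exact Metric.closedBall_subset_ball r.2.2

end Polydisc

/-! ### Rotations of the infinite torus -/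

/-- On the line the rotation is a translation by α; the intervals (0, 2π] and (α, α + 2π] are both
fundamental domains for 2πℤ, and the lifted set is periodic. -/
lemma circleMeasure_map_mul (α : ℝ) :
    circleMeasure.map (fun z => Circle.exp α * z) = circleMeasure := by
  ext B hB
  have hmul : Measurable fun z : Circle => Circle.exp α * z :=
    (continuous_const.mul continuous_id).measurable
  rw [Measure.map_apply hmul hB, circleMeasure, Measure.smul_apply, Measure.smul_apply,
    Measure.map_apply Circle.exp.continuous.measurable (hmul hB),
    Measure.map_apply Circle.exp.continuous.measurable hB]
  congr 1
  have hm : MeasurableSet (Circle.exp ⁻¹' B) := Circle.exp.continuous.measurable hB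
  have hfund (t : ℝ) := isAddFundamentalDomain_Ioc Real.two_pi_pos t volume
  have h1 : Circle.exp ⁻¹' ((fun z => Circle.exp α * z) ⁻¹' B) =
      (fun x => x + α) ⁻¹' (Circle.exp ⁻¹' B) := by
    ext x
    simp [Circle.exp_add, mul_comm]
  have h2 : (fun x => x + α) ⁻¹' (Set.Ioc α (α + 2 * Real.pi)) = Set.Ioc 0 (2 * Real.pi) := by
    ext x
    simp only [Set.mem_preimage, Set.mem_Ioc]
    constructor <;> rintro ⟨h, h'⟩ <;> constructor <;> linarith
  rw [h1, Measure.restrict_apply ((measurable_add_const α) hm), Measure.restrict_apply hm, ← h2,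
    ← Set.preimage_inter, measure_preimage_add_right]
  have h3 := (hfund α).measure_set_eq (hfund 0) hm (fun g => by
    obtain ⟨g, k, rfl⟩ := g
    ext x
    simp only [Set.mem_preimage, AddSubgroup.vadd_def, vadd_eq_add]
    rw [add_comm, zsmul_eq_mul, Circle.periodic_exp.int_mul k x])
  rw [zero_add] at h3
  rw [h3, h2]

instance : IsProbabilityMeasure torusMeasure :=
  inferInstanceAs (IsProbabilityMeasure (Measure.infinitePi fun _ => circleMeasure))

lemma continuous_rotate : Continuous fun x : ℝ × Torus => rotate x.1 x.2 := by
  refine continuous_pi fun n => ?_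
  unfold rotate
  fun_prop

lemma measurable_rotate : Measurable fun x : ℝ × Torus => rotate x.1 x.2 :=
  continuous_rotate.measurable

lemma measurable_rotate_left (θ : ℝ) : Measurable (rotate θ) := by
  refine Continuous.measurable (continuous_pi fun n => ?_)
  unfold rotate
  fun_prop

lemma torusMeasure_map_rotate (θ : ℝ) : torusMeasure.map (rotate θ) = torusMeasure := by
  have h := Measure.infinitePi_map_pi (fun _ : ℕ => circleMeasure)
    (f := fun n z => Circle.exp ((n + 1) * θ) * z)
    fun n => (continuous_const.mul continuous_id).measurable
  simp only [circleMeasure_map_mul] at h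
  exact h

/-- Integration over the torus by averaging over the orbits of the rotations. -/
lemma lintegral_torus_eq {Φ : Torus → ℝ≥0∞} (hΦ : Measurable Φ) :
    ∫⁻ w, Φ w ∂torusMeasure = ENNReal.ofReal (2 * Real.pi)⁻¹ *
      ∫⁻ w, (∫⁻ θ in Set.Ioc (-Real.pi) Real.pi, Φ (rotate θ w)) ∂torusMeasure := by
  have hm : Measurable (Function.uncurry fun (w : Torus) (θ : ℝ) => Φ (rotate θ w)) :=
    hΦ.comp (measurable_rotate.comp measurable_swap)
  rw [lintegral_lintegral_swap hm.aemeasurable]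
  have h (θ : ℝ) : ∫⁻ w, Φ (rotate θ w) ∂torusMeasure = ∫⁻ w, Φ w ∂torusMeasure := by
    rw [← lintegral_map hΦ (measurable_rotate_left θ), torusMeasure_map_rotate]
  simp only [h, setLIntegral_const, Real.volume_Ioc]
  rw [mul_left_comm, ← ENNReal.ofReal_mul (by positivity),
    show (2 * Real.pi)⁻¹ * (Real.pi - -Real.pi) = 1 by
      have := Real.pi_ne_zero
      field_simp
      ring, ENNReal.ofReal_one, mul_one]

/-! ### Maximal inequality on the infinite torus -/

section Maximal

variable {s : ℝ≥0∞} [Fact (1 ≤ s)] {F : polydisc s → ℂ}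

lemma IsHolomorphic.measurable_log_dilation (hs : s ≠ ∞) (hF : IsHolomorphic F)
    (r : Set.Ioo (0 : ℝ) 1) :
    Measurable fun w => ENNReal.ofReal (Real.log (1 + ‖dilation F r w‖)) := by
  have := (hF.continuous_dilation hs r).measurable
  fun_prop

/-- The sub-mean value inequality for `log (1 + |F|)` on the infinite torus. -/
lemma IsHolomorphic.log_one_add_norm_zero_le (hs : s ≠ ∞) (hF : IsHolomorphic F)
    (r : Set.Ioo (0 : ℝ) 1) :
    ENNReal.ofReal (Real.log (1 + ‖F ⟨0, zero_mem_polydisc⟩‖)) ≤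
      ∫⁻ w, ENNReal.ofReal (Real.log (1 + ‖dilation F r w‖)) ∂torusMeasure := by
  have hr := r.2.1
  have key (w : Torus) : ENNReal.ofReal (Real.log (1 + ‖F ⟨0, zero_mem_polydisc⟩‖)) ≤
      ENNReal.ofReal (2 * Real.pi)⁻¹ * ∫⁻ θ in Set.Ioc (-Real.pi) Real.pi,
        ENNReal.ofReal (Real.log (1 + ‖dilation F r (rotate θ w)‖)) := by
    have h := ofReal_log_one_add_norm_le_lintegral le_rfl hr (hF.diffContOnCl_slice hs w r) 0
    have hK (φ : ℝ) : poissonKernel 0 0 (circleMap 0 r φ) = 1 := by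
      rw [poissonKernel_def]
      simp [hr.ne']
    simpa only [circleMap_zero_radius, Function.const_apply, slice_zero, hK, ENNReal.ofReal_one,
      one_mul, zero_sub, zero_add, slice_circleMap hs] using h
  rw [lintegral_torus_eq (hF.measurable_log_dilation hs r), ← lintegral_const_mul']
  · calc _ = ∫⁻ _, ENNReal.ofReal (Real.log (1 + ‖F ⟨0, zero_mem_polydisc⟩‖)) ∂torusMeasure := by
          simp
      _ ≤ _ := lintegral_mono key
  · exact ENNReal.ofReal_ne_top

/-- The one-variable inequality has a constant independent of the slice, so it can be averaged over
the rotation orbits. Stopping at R < 1 keeps each slice regular up to the bounding circle. -/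
lemma IsHolomorphic.measure_radial_lt_mul_le (hs : s ≠ ∞) (hF : IsHolomorphic F) (c : ℝ)
    (R : Set.Ioo (0 : ℝ) 1) :
    torusMeasure {w | ∃ r < R, c < Real.log (1 + ‖dilation F r w‖)} * ENNReal.ofReal c ≤
      192 * ∫⁻ w, ENNReal.ofReal (Real.log (1 + ‖dilation F R w‖)) ∂torusMeasure := by
  set A := {w | ∃ r < R, c < Real.log (1 + ‖dilation F r w‖)} with hA
  -- The union over r is uncountable; measurability comes from openness.
  have hAo : IsOpen A := by
    have : A = ⋃ r, ⋃ (_ : r < R), {w | c < Real.log (1 + ‖dilation F r w‖)} := by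
      ext w; simp [hA]
    rw [this]
    refine isOpen_iUnion fun r => isOpen_iUnion fun _ => isOpen_lt continuous_const ?_
    exact (continuous_const.add (hF.continuous_dilation hs r).norm).log fun w =>
      (add_pos_of_pos_of_nonneg one_pos (norm_nonneg _)).ne'
  have hind : Measurable (A.indicator (1 : Torus → ℝ≥0∞)) :=
    measurable_one.indicator hAo.measurableSet
  have key (w : Torus) : (∫⁻ θ in Set.Ioc (-Real.pi) Real.pi,
      A.indicator (1 : Torus → ℝ≥0∞) (rotate θ w)) * ENNReal.ofReal c ≤
      192 * ∫⁻ θ in Set.Ioc (-Real.pi) Real.pi,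
        ENNReal.ofReal (Real.log (1 + ‖dilation F R (rotate θ w)‖)) := by
    have h := volume_radial_mul_le R.2.1 (hF.diffContOnCl_slice hs w R) c
    simp only [slice_circleMap hs] at h
    refine le_trans ?_ h
    gcongr
    have hpre : MeasurableSet ((fun θ => rotate θ w) ⁻¹' A) :=
      (measurable_rotate.comp measurable_prodMk_right) hAo.measurableSet
    have : (fun θ => A.indicator (1 : Torus → ℝ≥0∞) (rotate θ w)) =
        ((fun θ => rotate θ w) ⁻¹' A).indicator 1 := rfl
    rw [this, lintegral_indicator_one hpre, Measure.restrict_apply hpre]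
    refine measure_mono ?_
    rintro θ ⟨⟨r, hrR, hr⟩, hθ⟩
    refine ⟨hθ, r, r.2.1.le, hrR, ?_⟩
    rwa [slice_circleMap hs]
  have h1 : torusMeasure A = ∫⁻ w, A.indicator 1 w ∂torusMeasure :=
    (lintegral_indicator_one hAo.measurableSet).symm
  rw [h1, lintegral_torus_eq hind, lintegral_torus_eq (hF.measurable_log_dilation hs R), mul_assoc,
    mul_left_comm 192, ← lintegral_mul_const' _ _ ENNReal.ofReal_ne_top,
    ← lintegral_const_mul' 192 _ (by norm_num)]
  exact mul_le_mul' le_rfl (lintegral_mono key)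

/-- The weak type inequality for the radial maximal function of `log (1 + |F|)` on the infinite
torus. -/
lemma IsHolomorphic.measure_radial_mul_le (hs : s ≠ ∞) (hF : IsHolomorphic F) (c : ℝ) :
    torusMeasure {w | ∃ r, c < Real.log (1 + ‖dilation F r w‖)} * ENNReal.ofReal c ≤
      192 * ⨆ r, ∫⁻ w, ENNReal.ofReal (Real.log (1 + ‖dilation F r w‖)) ∂torusMeasure := by
  obtain ⟨u, hu, hu1, hulim⟩ := exists_seq_strictMono_tendsto' (show (0 : ℝ) < 1 by norm_num)
  let R : ℕ → Set.Ioo (0 : ℝ) 1 := fun n => ⟨u n, hu1 n⟩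
  have hR : Monotone R := hu.monotone
  have hunion : {w | ∃ r, c < Real.log (1 + ‖dilation F r w‖)} =
      ⋃ n, {w | ∃ r < R n, c < Real.log (1 + ‖dilation F r w‖)} := by
    ext w
    simp only [Set.mem_ofPred_eq, Set.mem_iUnion]
    constructor
    · rintro ⟨r, hr⟩
      obtain ⟨n, hn⟩ := (hulim.eventually (lt_mem_nhds r.2.2)).exists
      exact ⟨n, r, hn, hr⟩
    · rintro ⟨n, r, -, hr⟩
      exact ⟨r, hr⟩
  have hmono : Monotone fun n => {w | ∃ r < R n, c < Real.log (1 + ‖dilation F r w‖)} :=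
    fun m n hmn w ⟨r, hr, h⟩ => ⟨r, hr.trans_le (hR hmn), h⟩
  rw [hunion, hmono.measure_iUnion, ENNReal.iSup_mul]
  refine iSup_le fun n => (hF.measure_radial_lt_mul_le hs c (R n)).trans ?_
  gcongr
  exact le_iSup (fun r => ∫⁻ w, ENNReal.ofReal (Real.log (1 + ‖dilation F r w‖)) ∂torusMeasure) (R n)

end Maximal

/-! ### Logarithmic integrals of boundary functions -/

instance : IsCountablyGenerated toOne :=
  inferInstanceAs (IsCountablyGenerated (comap _ _))

instance : NeBot toOne := by
  refine comap_neBot fun t ht => ?_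
  obtain ⟨x, hx, hxt⟩ := mem_nhdsLT_iff_exists_Ioo_subset' (zero_lt_one (α := ℝ)) |>.1 ht
  obtain ⟨y, hy⟩ := exists_between (max_lt (Set.mem_Iio.1 hx) zero_lt_one)
  exact ⟨⟨y, (le_max_right _ _).trans_lt hy.1, hy.2⟩, hxt ⟨(le_max_left _ _).trans_lt hy.1, hy.2⟩⟩

lemma tendsto_val_toOne : Tendsto (Subtype.val : Set.Ioo (0 : ℝ) 1 → ℝ) toOne (𝓝 1) :=
  tendsto_comap.mono_right nhdsWithin_le_nhds

/-- Vitali's convergence theorem for integrals along a countably generated filter. -/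
lemma tendsto_integral_of_uniformIntegrable {α ι : Type*} {m : MeasurableSpace α} {μ : Measure α}
    [IsFiniteMeasure μ] {f : ι → α → ℝ} {g : α → ℝ} {l : Filter ι} [NeBot l]
    [IsCountablyGenerated l] (hf : UniformIntegrable f 1 μ)
    (hlim : ∀ᵐ x ∂μ, Tendsto (fun i => f i x) l (𝓝 (g x))) :
    Integrable g μ ∧ Tendsto (fun i => ∫ x, f i x ∂μ) l (𝓝 (∫ x, g x ∂μ)) := by
  have hg : Integrable g μ := hf.integrable_of_ae_tendsto hlim
  refine ⟨hg, tendsto_of_seq_tendsto fun u hu => ?_⟩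
  refine tendsto_integral_of_L1' (F := fun n => f (u n)) g hg.aestronglyMeasurable
    (Eventually.of_forall fun n => memLp_one_iff_integrable.1 (hf.memLp (u n))) ?_
  refine tendsto_Lp_finite_of_tendsto_ae le_rfl ENNReal.one_ne_top
    (fun n => hf.aestronglyMeasurable (u n)) (memLp_one_iff_integrable.2 hg) ?_ ?_
  · intro ε hε
    obtain ⟨δ, hδ, h⟩ := hf.unifIntegrable hε
    exact ⟨δ, hδ, fun n => h (u n)⟩
  · filter_upwards [hlim] with x hx
    exact hx.comp hu

/-- Passage to the limit `ε → 0` in the inequality `log (|a| + ε) ≤ ∫ log (|g| + ε)`. -/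
lemma log_norm_le_integral_of_forall {α : Type*} {m : MeasurableSpace α} {μ : Measure α}
    [IsProbabilityMeasure μ] {g : α → ℂ} {a : ℂ} (ha : a ≠ 0) (hg : AEStronglyMeasurable g μ)
    (hint : ∀ ε : ℝ, 0 < ε → ε ≤ 1 → Integrable (fun x => Real.log (1 + ‖g x‖ / ε)) μ)
    (hle : ∀ ε : ℝ, 0 < ε → ε ≤ 1 →
      Real.log (1 + ‖a‖ / ε) ≤ ∫ x, Real.log (1 + ‖g x‖ / ε) ∂μ) :
    (∀ᵐ x ∂μ, g x ≠ 0) ∧ Integrable (fun x => Real.log ‖g x‖) μ ∧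
      Real.log ‖a‖ ≤ ∫ x, Real.log ‖g x‖ ∂μ := by
  let e : ℕ → ℝ := fun k => 1 / ((k : ℝ) + 1)
  have e0 (k : ℕ) : 0 < e k := by positivity
  have e1 (k : ℕ) : e k ≤ 1 := by
    rw [div_le_one (by positivity)]
    linarith [k.cast_nonneg (α := ℝ)]
  have elim : Tendsto e atTop (𝓝 0) := tendsto_one_div_add_atTop_nhds_zero_nat
  have elog : ∀ k, ∀ x : ℝ, 0 ≤ x → Real.log (1 + x / e k) + Real.log (e k) = Real.log (e k + x) := by
    intro k x hx
    have := e0 k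
    rw [← Real.log_mul (by positivity) (by positivity)]
    congr 1
    field_simp
  have hi1 : Integrable (fun x => Real.log (1 + ‖g x‖)) μ := by simpa using hint 1 one_pos le_rfl
  -- φ_k = log(1+|g|) - log(|g| + e_k) is nonnegative, with integrals bounded by a constant K
  -- independent of k, so Fatou's lemma applies although log|g| may be very negative.
  let φ : ℕ → α → ℝ := fun k x => Real.log (1 + ‖g x‖) -
    (Real.log (1 + ‖g x‖ / e k) + Real.log (e k))
  have hφi (k : ℕ) : Integrable (φ k) μ :=
    hi1.sub ((hint _ (e0 k) (e1 k)).add (integrable_const _))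
  have hφ0 (k : ℕ) (x : α) : 0 ≤ φ k x := by
    simp only [φ]
    rw [elog k _ (norm_nonneg _), sub_nonneg]
    exact Real.log_le_log (add_pos_of_pos_of_nonneg (e0 k) (norm_nonneg _))
      (by linarith [e1 k])
  set K := ∫ x, Real.log (1 + ‖g x‖) ∂μ - Real.log ‖a‖ with hK
  have hφK (k : ℕ) : ∫ x, φ k x ∂μ ≤ K := by
    have h1 : ∫ x, φ k x ∂μ = ∫ x, Real.log (1 + ‖g x‖) ∂μ -
        (∫ x, Real.log (1 + ‖g x‖ / e k) ∂μ + Real.log (e k)) := by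
      have h2 : Integrable (fun x => Real.log (1 + ‖g x‖ / e k) + Real.log (e k)) μ :=
        (hint _ (e0 k) (e1 k)).add (integrable_const _)
      simp only [φ]
      rw [integral_sub hi1 h2, integral_add (hint _ (e0 k) (e1 k)) (integrable_const _)]
      simp
    have h2 := hle _ (e0 k) (e1 k)
    have h3 : Real.log ‖a‖ ≤ Real.log (e k + ‖a‖) :=
      Real.log_le_log (norm_pos_iff.2 ha) (by linarith [e0 k])
    rw [← elog k _ (norm_nonneg a)] at h3
    rw [h1, hK]
    linarith
  have hK0 : 0 ≤ K := (integral_nonneg (hφ0 0)).trans (hφK 0)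
  have hfatou : ∫⁻ x, liminf (fun k => ENNReal.ofReal (φ k x)) atTop ∂μ ≤ ENNReal.ofReal K := by
    refine (lintegral_liminf_le' fun k =>
      (hφi k).aestronglyMeasurable.aemeasurable.ennreal_ofReal).trans ?_
    refine liminf_le_of_le (by isBoundedDefault) fun b hb => ?_
    obtain ⟨k, hk⟩ := hb.exists
    refine hk.trans ?_
    rw [← ofReal_integral_eq_lintegral_ofReal (hφi k) (ae_of_all _ (hφ0 k))]
    exact ENNReal.ofReal_le_ofReal (hφK k)
  -- Where g vanishes, φ_k = -log e_k tends to infinity, which a finite Fatou bound excludes off a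
  -- null set.
  have hne : ∀ᵐ x ∂μ, g x ≠ 0 := by
    have hfin : ∀ᵐ x ∂μ, liminf (fun k => ENNReal.ofReal (φ k x)) atTop < ∞ := by
      refine ae_lt_top' ?_ ?_
      · simp only [liminf_eq_iSup_iInf_of_nat]
        exact .iSup fun n => .biInf _ (Set.to_countable _) fun k _ =>
          (hφi k).aestronglyMeasurable.aemeasurable.ennreal_ofReal
      exact (hfatou.trans_lt ENNReal.ofReal_lt_top).ne
    filter_upwards [hfin] with x hx h0
    have h1 : Tendsto (fun k => ENNReal.ofReal (φ k x)) atTop (𝓝 ∞) := by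
      refine ENNReal.tendsto_ofReal_nhds_top.2 ?_
      have : (fun k => φ k x) = fun k => - Real.log (e k) := by
        ext k
        simp [φ, h0]
      rw [this]
      refine tendsto_neg_atBot_atTop.comp (Real.tendsto_log_nhdsGT_zero.comp ?_)
      exact tendsto_nhdsWithin_iff.2 ⟨elim, Eventually.of_forall e0⟩
    rw [h1.liminf_eq] at hx
    exact lt_irrefl _ hx
  have hφlim : ∀ᵐ x ∂μ, liminf (fun k => ENNReal.ofReal (φ k x)) atTop =
      ENNReal.ofReal (Real.log (1 + ‖g x‖) - Real.log ‖g x‖) := by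
    filter_upwards [hne] with x hx
    refine Tendsto.liminf_eq (ENNReal.tendsto_ofReal ?_)
    refine tendsto_const_nhds.sub ?_
    simp only [elog _ _ (norm_nonneg _)]
    have : Tendsto (fun k => e k + ‖g x‖) atTop (𝓝 ‖g x‖) := by
      simpa using elim.add_const ‖g x‖
    exact this.log (norm_ne_zero_iff.2 hx)
  rw [lintegral_congr_ae hφlim] at hfatou
  have hψ0 : ∀ᵐ x ∂μ, 0 ≤ Real.log (1 + ‖g x‖) - Real.log ‖g x‖ := by
    filter_upwards [hne] with x hx
    rw [sub_nonneg]
    exact Real.log_le_log (norm_pos_iff.2 hx) (by linarith)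
  have hψm : AEStronglyMeasurable (fun x => Real.log (1 + ‖g x‖) - Real.log ‖g x‖) μ :=
    hi1.aestronglyMeasurable.sub
      (Real.measurable_log.comp_aemeasurable hg.norm.aemeasurable).aestronglyMeasurable
  have hψi : Integrable (fun x => Real.log (1 + ‖g x‖) - Real.log ‖g x‖) μ := by
    refine ⟨hψm, ?_⟩
    rw [hasFiniteIntegral_iff_ofReal hψ0]
    exact hfatou.trans_lt ENNReal.ofReal_lt_top
  have hψK : ∫ x, (Real.log (1 + ‖g x‖) - Real.log ‖g x‖) ∂μ ≤ K := by
    rw [integral_eq_lintegral_of_nonneg_ae hψ0 hψm]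
    exact ENNReal.toReal_le_of_le_ofReal hK0 hfatou
  have hlog : Integrable (fun x => Real.log ‖g x‖) μ := by
    refine (hi1.sub hψi).congr (ae_of_all _ fun x => ?_)
    simp
  refine ⟨hne, hlog, ?_⟩
  rw [integral_sub hi1 hlog, hK] at hψK
  linarith

/-- For fixed ε the regularised logarithm differs from log⁺ by a bounded amount. Dominated
convergence handles the difference, so only the integrals of log⁺ need uniform integrability. -/
lemma log_one_add_div_sub_posLog_mem {x ε : ℝ} (hx : 0 ≤ x) (h0 : 0 < ε) (h1 : ε ≤ 1) :
    0 ≤ Real.log (1 + x / ε) - Real.posLog x ∧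
      Real.log (1 + x / ε) - Real.posLog x ≤ Real.log (1 + 1 / ε) := by
  rw [Real.posLog_eq_log_max_one hx]
  have hxε : x ≤ x / ε := le_div_self hx h0 h1
  have hm : (0 : ℝ) < max 1 x := lt_max_of_lt_left one_pos
  constructor
  · rw [sub_nonneg]
    refine Real.log_le_log hm (max_le ?_ ?_) <;> linarith [div_nonneg hx h0.le]
  · rw [sub_le_iff_le_add, ← Real.log_mul (by positivity) hm.ne']
    refine Real.log_le_log (by positivity) ?_
    have h2 : x / ε ≤ 1 / ε * max 1 x := by
      rw [div_eq_mul_one_div, mul_comm]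
      gcongr
      exact le_max_right _ _
    have h3 : (1 : ℝ) ≤ max 1 x := le_max_left _ _
    linarith

/-! ### Jensen's inequality on the infinite torus -/

section Jensen

variable {s : ℝ≥0∞} [Fact (1 ≤ s)] {F : polydisc s → ℂ}

lemma integrable_of_continuous_torus {f : Torus → ℝ} (hf : Continuous f) :
    Integrable f torusMeasure := by
  obtain ⟨C, hC⟩ := isCompact_univ.exists_bound_of_continuousOn hf.continuousOn
  exact (integrable_const C).mono' hf.aestronglyMeasurable (ae_of_all _ fun x => hC x trivial)

/-- The sub-mean value inequality for F/ε; adding log ε to both sides makes it one for log(|F| + ε).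
-/
lemma IsHolomorphic.log_one_add_div_le_integral (hs : s ≠ ∞) (hF : IsHolomorphic F)
    (r : Set.Ioo (0 : ℝ) 1) {ε : ℝ} (hε : 0 < ε) :
    Real.log (1 + ‖F ⟨0, zero_mem_polydisc⟩‖ / ε) ≤
      ∫ w, Real.log (1 + ‖dilation F r w‖ / ε) ∂torusMeasure := by
  have hdil (w : Torus) : ‖dilation (((ε⁻¹ : ℝ) : ℂ) • F) r w‖ = ‖dilation F r w‖ / ε := by
    change ‖((ε⁻¹ : ℝ) : ℂ) * dilation F r w‖ = _
    rw [norm_mul, Complex.norm_real, Real.norm_of_nonneg (by positivity)]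
    ring
  have h := (hF.const_smul ((ε⁻¹ : ℝ) : ℂ)).log_one_add_norm_zero_le hs r
  simp only [hdil] at h
  have h0 : ‖(((ε⁻¹ : ℝ) : ℂ) • F) ⟨0, zero_mem_polydisc⟩‖ = ‖F ⟨0, zero_mem_polydisc⟩‖ / ε := by
    rw [Pi.smul_apply, smul_eq_mul, norm_mul, Complex.norm_real,
      Real.norm_of_nonneg (by positivity)]
    ring
  have hnn (w : Torus) : 0 ≤ Real.log (1 + ‖dilation F r w‖ / ε) :=
    Real.log_nonneg (le_add_of_nonneg_right (by positivity))
  have hc : Continuous fun w => Real.log (1 + ‖dilation F r w‖ / ε) := by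
    refine Continuous.log ?_ fun w => by positivity
    exact continuous_const.add ((hF.continuous_dilation hs r).norm.div_const ε)
  rw [h0, ← ofReal_integral_eq_lintegral_ofReal (integrable_of_continuous_torus hc)
    (ae_of_all _ hnn)] at h
  exact (ENNReal.ofReal_le_ofReal_iff (integral_nonneg hnn)).1 h

/-- Jensen's inequality `log |F(0)| ≤ ∫ log |F^*|`, for functions whose means of `log⁺ |F_[r]|`
converge to that of `log⁺ |F^*|`. -/
lemma IsHolomorphic.log_norm_zero_le_integral (hs : s ≠ ∞) (hF : IsHolomorphic F)
    (h0 : F ⟨0, zero_mem_polydisc⟩ ≠ 0) {g : Torus → ℂ}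
    (hg : ∀ᵐ w ∂torusMeasure, Tendsto (fun r => dilation F r w) toOne (𝓝 (g w)))
    (hgi : Integrable (fun w => Real.posLog ‖g w‖) torusMeasure)
    (hlim : Tendsto (fun r => ∫ w, Real.posLog ‖dilation F r w‖ ∂torusMeasure) toOne
      (𝓝 (∫ w, Real.posLog ‖g w‖ ∂torusMeasure))) :
    (∀ᵐ w ∂torusMeasure, g w ≠ 0) ∧ Integrable (fun w => Real.log ‖g w‖) torusMeasure ∧
      Real.log ‖F ⟨0, zero_mem_polydisc⟩‖ ≤ ∫ w, Real.log ‖g w‖ ∂torusMeasure := by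
  have hgm : AEStronglyMeasurable g torusMeasure :=
    aestronglyMeasurable_of_tendsto_ae toOne
      (fun r => (hF.continuous_dilation hs r).aestronglyMeasurable) hg
  have hpos (ε : ℝ) (hε : 0 < ε) (x : ℂ) : 0 < 1 + ‖x‖ / ε := by positivity
  have hcont (ε : ℝ) (hε : 0 < ε) :
      Continuous fun x : ℂ => Real.log (1 + ‖x‖ / ε) - Real.posLog ‖x‖ :=
    (Continuous.log (by fun_prop) fun x => (hpos ε hε x).ne').sub
      (Real.continuous_posLog.comp continuous_norm)
  have hbd (ε : ℝ) (hε : 0 < ε) (hε1 : ε ≤ 1) (x : ℂ) :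
      ‖Real.log (1 + ‖x‖ / ε) - Real.posLog ‖x‖‖ ≤ Real.log (1 + 1 / ε) := by
    have h := log_one_add_div_sub_posLog_mem (norm_nonneg x) hε hε1
    rw [Real.norm_of_nonneg h.1]
    exact h.2
  have hdi (ε : ℝ) (hε : 0 < ε) (hε1 : ε ≤ 1) :
      Integrable (fun w => Real.log (1 + ‖g w‖ / ε) - Real.posLog ‖g w‖) torusMeasure :=
    (integrable_const (Real.log (1 + 1 / ε))).mono'
      ((hcont ε hε).comp_aestronglyMeasurable hgm) (ae_of_all _ fun w => hbd ε hε hε1 (g w))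
  have hpi (r : Set.Ioo (0 : ℝ) 1) :
      Integrable (fun w => Real.posLog ‖dilation F r w‖) torusMeasure :=
    integrable_of_continuous_torus
      (Real.continuous_posLog.comp (hF.continuous_dilation hs r).norm)
  have hint (ε : ℝ) (hε : 0 < ε) (hε1 : ε ≤ 1) :
      Integrable (fun w => Real.log (1 + ‖g w‖ / ε)) torusMeasure := by
    refine ((hdi ε hε hε1).add hgi).congr (ae_of_all _ fun w => ?_)
    simp
  refine log_norm_le_integral_of_forall h0 hgm hint fun ε hε hε1 => ?_
  have h1 : Tendsto (fun r => ∫ w, (Real.log (1 + ‖dilation F r w‖ / ε) -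
      Real.posLog ‖dilation F r w‖) ∂torusMeasure) toOne
      (𝓝 (∫ w, (Real.log (1 + ‖g w‖ / ε) - Real.posLog ‖g w‖) ∂torusMeasure)) := by
    refine tendsto_integral_filter_of_dominated_convergence (fun _ => Real.log (1 + 1 / ε))
      (Eventually.of_forall fun r =>
        ((hcont ε hε).comp (hF.continuous_dilation hs r)).aestronglyMeasurable)
      (Eventually.of_forall fun r => ae_of_all _ fun w => hbd ε hε hε1 _) (integrable_const _) ?_
    filter_upwards [hg] with w hw
    exact (hcont ε hε).continuousAt.tendsto.comp hw
  have h2 := h1.add hlim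
  rw [← integral_add (hdi ε hε hε1) hgi] at h2
  simp only [sub_add_cancel] at h2
  refine ge_of_tendsto h2 (Eventually.of_forall fun r => ?_)
  have hci : Integrable (fun w => Real.log (1 + ‖dilation F r w‖ / ε) -
      Real.posLog ‖dilation F r w‖) torusMeasure :=
    integrable_of_continuous_torus ((hcont ε hε).comp (hF.continuous_dilation hs r))
  rw [← integral_add hci (hpi r)]
  simp only [sub_add_cancel]
  exact hF.log_one_add_div_le_integral hs r hε

/-- The values on the torus of a polynomial. -/
def torusPoly (q : MvPolynomial ℕ ℂ) (w : Torus) : ℂ :=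
  MvPolynomial.eval (fun n => (w n : ℂ)) q

lemma continuous_torusPoly (q : MvPolynomial ℕ ℂ) : Continuous (torusPoly q) :=
  (MvPolynomial.continuous_eval q).comp (by fun_prop)

lemma tendsto_dilation_polyFun (q : MvPolynomial ℕ ℂ) (w : Torus) :
    Tendsto (fun r => dilation (polyFun s q) r w) toOne (𝓝 (torusPoly q w)) := by
  refine (MvPolynomial.continuous_eval q).continuousAt.tendsto.comp ?_
  refine tendsto_pi_nhds.2 fun n => ?_
  have h : Tendsto (fun r : Set.Ioo (0 : ℝ) 1 => ((r : ℝ) : ℂ) ^ (n + 1) * (w n : ℂ)) toOne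
      (𝓝 (((1 : ℝ) : ℂ) ^ (n + 1) * (w n : ℂ))) :=
    (((Complex.continuous_ofReal.tendsto 1).comp tendsto_val_toOne).pow (n + 1)).mul_const _
  rw [Complex.ofReal_one, one_pow, one_mul] at h
  exact h

/-- Jensen's inequality for polynomials on the infinite torus. -/
lemma log_norm_polyFun_zero_le_integral {q : MvPolynomial ℕ ℂ}
    (h0 : polyFun 1 q ⟨0, zero_mem_polydisc⟩ ≠ 0) :
    (∀ᵐ w ∂torusMeasure, torusPoly q w ≠ 0) ∧
      Integrable (fun w => Real.log ‖torusPoly q w‖) torusMeasure ∧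
      Real.log ‖polyFun 1 q ⟨0, zero_mem_polydisc⟩‖ ≤
        ∫ w, Real.log ‖torusPoly q w‖ ∂torusMeasure := by
  obtain ⟨M, hM⟩ := exists_norm_polyFun_le (s := 1) q
  have hq := isHolomorphic_polyFun (s := 1) q
  refine hq.log_norm_zero_le_integral ENNReal.one_ne_top h0
    (ae_of_all _ (tendsto_dilation_polyFun q))
    (integrable_of_continuous_torus
      (Real.continuous_posLog.comp (continuous_torusPoly q).norm)) ?_
  refine tendsto_integral_filter_of_dominated_convergence (fun _ => Real.posLog M)
    (Eventually.of_forall fun r => (Real.continuous_posLog.comp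
      (hq.continuous_dilation ENNReal.one_ne_top r).norm).aestronglyMeasurable)
    (Eventually.of_forall fun r => ae_of_all _ fun w => ?_) (integrable_const _)
    (ae_of_all _ fun w => (Real.continuous_posLog.comp continuous_norm).continuousAt.tendsto.comp
      (tendsto_dilation_polyFun q w))
  rw [Real.norm_of_nonneg Real.posLog_nonneg]
  exact Real.posLog_le_posLog (norm_nonneg _) (hM _)

end Jensen

/-! ### Functions with approximate polynomial inverses are outer -/

/-- A family `a` along `l` that has approximate inverses `b n` of convergent families converges
to a nonzero limit. -/
lemma exists_tendsto_of_approx_inverse {ι : Type*} {l : Filter ι} [NeBot l] {a : ι → ℂ}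
    {b : ℕ → ι → ℂ} {β : ℕ → ℂ} {δ : ℕ → ℝ} (hb : ∀ n, Tendsto (b n) l (𝓝 (β n)))
    (hβ : ∀ n, β n ≠ 0) (hδ : Tendsto δ atTop (𝓝 0))
    (hab : ∀ᶠ n in atTop, ∀ i, ‖1 - b n i * a i‖ ≤ δ n) :
    ∃ α : ℂ, α ≠ 0 ∧ Tendsto a l (𝓝 α) := by
  -- Along an ultrafilter on which a → α, the hypothesis passes to the limit as |1 - β_n α| ≤ δ_n.
  -- So β_n → α⁻¹ for every cluster point α, and there is at most one.
  have hclus : ∀ α : ℂ, MapClusterPt α l a → Tendsto (fun n => β n * α) atTop (𝓝 1) := by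
    intro α hα
    obtain ⟨U, hUl, hU⟩ := mapClusterPt_iff_ultrafilter.1 hα
    rw [tendsto_iff_norm_sub_tendsto_zero]
    refine squeeze_zero' (Eventually.of_forall fun _ => norm_nonneg _) ?_ hδ
    filter_upwards [hab] with n hn
    have h1 : Tendsto (fun i => ‖1 - b n i * a i‖) U (𝓝 ‖1 - β n * α‖) :=
      (tendsto_const_nhds.sub (((hb n).mono_left hUl).mul hU)).norm
    rw [norm_sub_rev]
    exact le_of_tendsto h1 (Eventually.of_forall hn)
  have hinv : ∀ α : ℂ, MapClusterPt α l a → α ≠ 0 ∧ Tendsto β atTop (𝓝 α⁻¹) := by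
    intro α hα
    have h := hclus α hα
    have h0 : α ≠ 0 := by
      rintro rfl
      simp only [mul_zero] at h
      exact zero_ne_one (tendsto_nhds_unique tendsto_const_nhds h)
    refine ⟨h0, ?_⟩
    have h2 := h.mul_const α⁻¹
    simpa [mul_assoc, h0] using h2
  -- A single index bounds a near the limit, since b_n stays away from 0 there; compactness then
  -- supplies a cluster point.
  obtain ⟨n, hn⟩ := hab.exists
  have hbn : 0 < ‖β n‖ := norm_pos_iff.2 (hβ n)
  have hK : ∀ᶠ i in l, a i ∈ Metric.closedBall (0 : ℂ) ((1 + δ n) / (‖β n‖ / 2)) := by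
    have h1 : ∀ᶠ i in l, ‖β n‖ / 2 < ‖b n i‖ :=
      (hb n).norm.eventually (lt_mem_nhds (by linarith))
    filter_upwards [h1] with i hi
    rw [mem_closedBall_zero_iff, le_div_iff₀ (by positivity)]
    have h2 : ‖b n i * a i‖ ≤ 1 + δ n := by
      have := norm_sub_norm_le (b n i * a i) 1
      rw [norm_sub_rev, norm_one] at this
      linarith [hn i]
    rw [norm_mul] at h2
    nlinarith [norm_nonneg (a i)]
  obtain ⟨α, -, hα⟩ := (isCompact_closedBall (0 : ℂ) ((1 + δ n) / (‖β n‖ / 2))).exists_mapClusterPt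
    (f := l) (u := a) (by rwa [le_principal_iff, mem_map])
  refine ⟨α, (hinv α hα).1, (isCompact_closedBall _ _).tendsto_nhds_of_unique_mapClusterPt hK ?_⟩
  intro α' _ hα'
  exact inv_injective (tendsto_nhds_unique (hinv α' hα').2 (hinv α hα).2)

section Outer

variable {F : polydisc 1 → ℂ} {q : ℕ → MvPolynomial ℕ ℂ}

lemma dilation_one_sub_mul (F : polydisc 1 → ℂ) (q : MvPolynomial ℕ ℂ) (r : Set.Ioo (0 : ℝ) 1)
    (w : Torus) : dilation (1 - polyFun 1 q * F) r w =
      1 - dilation (polyFun 1 q) r w * dilation F r w := rfl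

lemma isHolomorphic_one_sub_mul (hF : IsHolomorphic F) (q : MvPolynomial ℕ ℂ) :
    IsHolomorphic (1 - polyFun 1 q * F) := by
  have h := (isHolomorphic_const (V := polydisc 1) 1).add
    (((isHolomorphic_polyFun (s := 1) q).mul hF).const_smul (-1))
  convert h using 1
  ext ζ
  simp [sub_eq_add_neg]

/-- Evaluation at 0 is controlled by ‖·‖_0 through the sub-mean value inequality at any one radius;
1/2 is an arbitrary choice. -/
lemma norm_one_sub_zero_lt_of_nevanlinnaNorm_le (hF : IsHolomorphic F) {p : MvPolynomial ℕ ℂ}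
    {c : ℝ} (hc : 0 ≤ c) (hp : nevanlinnaNorm (1 - polyFun 1 p * F) ≤ ENNReal.ofReal c) :
    ‖1 - polyFun 1 p ⟨0, zero_mem_polydisc⟩ * F ⟨0, zero_mem_polydisc⟩‖ ≤ Real.exp c - 1 := by
  have h := (isHolomorphic_one_sub_mul hF p).log_one_add_norm_zero_le ENNReal.one_ne_top
    ⟨1 / 2, by norm_num, by norm_num⟩
  have h2 := h.trans ((le_iSup (fun r => ∫⁻ w, ENNReal.ofReal (Real.log (1 +
    ‖dilation (1 - polyFun 1 p * F) r w‖)) ∂torusMeasure) _).trans hp)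
  rw [ENNReal.ofReal_le_ofReal_iff hc, Real.log_le_iff_le_exp (by positivity)] at h2
  change 1 + ‖1 - polyFun 1 p ⟨0, zero_mem_polydisc⟩ * F ⟨0, zero_mem_polydisc⟩‖ ≤ _ at h2
  linarith

/-- The weak type inequality at level 2^{-(n+1)} against norm 4^{-(n+1)} leaves exceptional sets of
measure at most 192 · 2^{-(n+1)}; Borel–Cantelli concludes. Uniformity in r is what produces radial
limits of F. -/
lemma ae_eventually_norm_one_sub_le (hF : IsHolomorphic F)
    (hq : ∀ n, nevanlinnaNorm (1 - polyFun 1 (q n) * F) ≤ ENNReal.ofReal ((1 / 4) ^ (n + 1))) :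
    ∀ᵐ w ∂torusMeasure, ∀ᶠ n in atTop, ∀ r,
      ‖1 - dilation (polyFun 1 (q n)) r w * dilation F r w‖ ≤ Real.exp ((1 / 2) ^ (n + 1)) - 1 := by
  set B : ℕ → Set Torus := fun n => {w | ∃ r, (1 / 2 : ℝ) ^ (n + 1) <
    Real.log (1 + ‖dilation (1 - polyFun 1 (q n) * F) r w‖)} with hB
  have hBn (n : ℕ) : torusMeasure (B n) ≤ 192 * ENNReal.ofReal ((1 / 2) ^ (n + 1)) := by
    have h := (isHolomorphic_one_sub_mul hF (q n)).measure_radial_mul_le ENNReal.one_ne_top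
      ((1 / 2 : ℝ) ^ (n + 1))
    have h2 := h.trans (mul_le_mul' le_rfl (hq n))
    have h3 : ENNReal.ofReal ((1 / 4) ^ (n + 1)) =
        ENNReal.ofReal ((1 / 2) ^ (n + 1)) * ENNReal.ofReal ((1 / 2) ^ (n + 1)) := by
      rw [← ENNReal.ofReal_mul (by positivity), ← mul_pow]
      norm_num
    rw [h3, ← mul_assoc] at h2
    exact (ENNReal.mul_le_mul_iff_left (by simp) ENNReal.ofReal_ne_top).1 h2
  have hsum : ∑' n, torusMeasure (B n) ≠ ∞ := by
    refine ne_top_of_le_ne_top ?_ (ENNReal.tsum_le_tsum hBn)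
    rw [ENNReal.tsum_mul_left, ← ENNReal.ofReal_tsum_of_nonneg (fun n => by positivity)]
    · exact ENNReal.mul_ne_top (by norm_num) ENNReal.ofReal_ne_top
    · exact summable_pow_succ (by norm_num) (by norm_num)
  filter_upwards [ae_eventually_notMem hsum] with w hw
  filter_upwards [hw] with n hn r
  have h : ¬ (1 / 2 : ℝ) ^ (n + 1) < Real.log (1 + ‖dilation (1 - polyFun 1 (q n) * F) r w‖) :=
    fun h => hn ⟨r, h⟩
  rw [not_lt, Real.log_le_iff_le_exp (by positivity), dilation_one_sub_mul] at h
  linarith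

/-- Fatou's lemma for the boundary values of `1 - q F`. -/
lemma integral_log_le_of_nevanlinnaNorm_le (hF : IsHolomorphic F) {p : MvPolynomial ℕ ℂ} {c : ℝ}
    (hc : 0 ≤ c) (hp : nevanlinnaNorm (1 - polyFun 1 p * F) ≤ ENNReal.ofReal c) {g : Torus → ℂ}
    (hg : ∀ᵐ w ∂torusMeasure, Tendsto (fun r => dilation F r w) toOne (𝓝 (g w)))
    (hi : Integrable (fun w => Real.log ‖torusPoly p w * g w‖) torusMeasure)
    (h0 : ∀ᵐ w ∂torusMeasure, torusPoly p w * g w ≠ 0) :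
    ∫ w, Real.log ‖torusPoly p w * g w‖ ∂torusMeasure ≤ c := by
  have hgm : AEStronglyMeasurable g torusMeasure :=
    aestronglyMeasurable_of_tendsto_ae toOne
      (fun r => (hF.continuous_dilation ENNReal.one_ne_top r).aestronglyMeasurable) hg
  have hL : Continuous fun x : ℂ => Real.log (1 + ‖x‖) :=
    Continuous.log (by fun_prop) fun x => by positivity
  have hm : AEStronglyMeasurable (fun w => Real.log (1 + ‖1 - torusPoly p w * g w‖))
      torusMeasure :=
    hL.comp_aestronglyMeasurable (aestronglyMeasurable_const.sub
      ((continuous_torusPoly p).aestronglyMeasurable.mul hgm))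
  have hfatou : ∫⁻ w, ENNReal.ofReal (Real.log (1 + ‖1 - torusPoly p w * g w‖)) ∂torusMeasure ≤
      ENNReal.ofReal c := by
    have hlim : ∀ᵐ w ∂torusMeasure, liminf (fun r => ENNReal.ofReal (Real.log (1 +
        ‖dilation (1 - polyFun 1 p * F) r w‖))) toOne =
        ENNReal.ofReal (Real.log (1 + ‖1 - torusPoly p w * g w‖)) := by
      filter_upwards [hg] with w hw
      refine Tendsto.liminf_eq (ENNReal.tendsto_ofReal ?_)
      refine hL.continuousAt.tendsto.comp ?_
      exact tendsto_const_nhds.sub ((tendsto_dilation_polyFun p w).mul hw)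
    rw [← lintegral_congr_ae hlim]
    refine (lintegral_liminf_le fun r => (isHolomorphic_one_sub_mul hF p).measurable_log_dilation
      ENNReal.one_ne_top r).trans ?_
    refine liminf_le_of_le (by isBoundedDefault) fun b hb => ?_
    obtain ⟨r, hr⟩ := hb.exists
    exact hr.trans ((le_iSup (fun r => ∫⁻ w, ENNReal.ofReal (Real.log (1 +
      ‖dilation (1 - polyFun 1 p * F) r w‖)) ∂torusMeasure) r).trans hp)
  have hnn : ∀ᵐ w ∂torusMeasure, 0 ≤ Real.log (1 + ‖1 - torusPoly p w * g w‖) :=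
    ae_of_all _ fun w => log_one_add_norm_nonneg _
  have hi2 : Integrable (fun w => Real.log (1 + ‖1 - torusPoly p w * g w‖)) torusMeasure := by
    refine ⟨hm, ?_⟩
    rw [hasFiniteIntegral_iff_ofReal hnn]
    exact hfatou.trans_lt ENNReal.ofReal_lt_top
  -- Pointwise |x| ≤ 1 + |1 - x|.
  have h1 : ∫ w, Real.log ‖torusPoly p w * g w‖ ∂torusMeasure ≤
      ∫ w, Real.log (1 + ‖1 - torusPoly p w * g w‖) ∂torusMeasure := by
    refine integral_mono_ae hi hi2 ?_
    filter_upwards [h0] with w hw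
    refine Real.log_le_log (norm_pos_iff.2 hw) ?_
    have := norm_sub_norm_le (torusPoly p w * g w) 1
    rw [norm_sub_rev, norm_one] at this
    linarith
  refine h1.trans ?_
  rw [integral_eq_lintegral_of_nonneg_ae hnn hm]
  exact ENNReal.toReal_le_of_le_ofReal hc hfatou

lemma torusPoissonKernel_zero (w : Torus) :
    torusPoissonKernel ⟨0, zero_mem_polydisc⟩ w = 1 := by
  simp [torusPoissonKernel, Circle.norm_coe]

/-- A function in the Smirnov class for which `1` is a limit of polynomial multiples is outer. -/
theorem isOuter_of_forall_exists_nevanlinnaNorm_lt (hF : F ∈ smirnovClass)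
    (happrox : ∀ ε : ℝ≥0∞, 0 < ε → ∃ p, nevanlinnaNorm (1 - polyFun 1 p * F) < ε) :
    IsOuter F := by
  have hol : IsHolomorphic F := hF.1.1
  have hpos (n : ℕ) : (0 : ℝ≥0∞) < ENNReal.ofReal ((1 / 4) ^ (n + 1)) :=
    ENNReal.ofReal_pos.2 (by positivity)
  choose q hq using fun n => happrox _ (hpos n)
  have hq' (n : ℕ) := (hq n).le
  have hz (n : ℕ) := norm_one_sub_zero_lt_of_nevanlinnaNorm_le hol (by positivity) (hq' n)
  -- Since 1/4 < log 2, the distance from q_n(0) F(0) to 1 is below 1, so neither factor vanishes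
  -- and Jensen's inequality applies to both.
  have hlt1 (n : ℕ) : Real.exp ((1 / 4) ^ (n + 1)) - 1 < 1 := by
    have h1 : ((1 : ℝ) / 4) ^ (n + 1) ≤ 1 / 4 :=
      pow_le_of_le_one (by norm_num) (by norm_num) (Nat.succ_ne_zero n)
    have h2 : Real.exp ((1 / 4) ^ (n + 1)) < Real.exp (Real.log 2) :=
      Real.exp_lt_exp.2 (by linarith [Real.log_two_gt_d9])
    rw [Real.exp_log two_pos] at h2
    linarith
  have hne (n : ℕ) : polyFun 1 (q n) ⟨0, zero_mem_polydisc⟩ * F ⟨0, zero_mem_polydisc⟩ ≠ 0 := by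
    intro h
    have := hz n
    rw [h, sub_zero, norm_one] at this
    linarith [hlt1 n]
  have hF0 : F ⟨0, zero_mem_polydisc⟩ ≠ 0 := right_ne_zero_of_mul (hne 0)
  have hJ (n : ℕ) := log_norm_polyFun_zero_le_integral (left_ne_zero_of_mul (hne n))
  have htend (u : ℝ) (h0 : 0 ≤ u) (h1 : u < 1) :
      Tendsto (fun n : ℕ => Real.exp (u ^ (n + 1)) - 1) atTop (𝓝 0) := by
    have h := ((tendsto_pow_atTop_nhds_zero_of_lt_one h0 h1).comp (tendsto_add_atTop_nat 1))
    have h2 := ((Real.continuous_exp.tendsto 0).comp h).sub_const 1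
    simpa [Function.comp_def] using h2
  have hlim : ∀ᵐ w ∂torusMeasure,
      Tendsto (fun r => dilation F r w) toOne (𝓝 (boundary F w)) ∧ boundary F w ≠ 0 := by
    filter_upwards [ae_eventually_norm_one_sub_le hol hq', ae_all_iff.2 fun n => (hJ n).1]
      with w h1 h2
    obtain ⟨α, hα, hlimα⟩ := exists_tendsto_of_approx_inverse
      (fun n => tendsto_dilation_polyFun (q n) w) h2 (htend (1 / 2) (by norm_num) (by norm_num)) h1
    have : boundary F w = α := hlimα.limUnder_eq
    rw [this]
    exact ⟨hlimα, hα⟩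
  have hlim' := hlim.mono fun w h => h.1
  obtain ⟨hgi, hglim⟩ := tendsto_integral_of_uniformIntegrable
    (g := fun w => Real.posLog ‖boundary F w‖) hF.2 (hlim'.mono fun w h =>
      (Real.continuous_posLog.comp continuous_norm).continuousAt.tendsto.comp h)
  obtain ⟨-, hint, hle⟩ := hol.log_norm_zero_le_integral ENNReal.one_ne_top hF0 hlim' hgi hglim
  refine ⟨hF, fun h => hF0 (by rw [h]; rfl), hlim, ⟨0, zero_mem_polydisc⟩, hF0, ?_, ?_⟩
  · simpa only [torusPoissonKernel_zero, one_mul] using hint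
  simp only [torusPoissonKernel_zero, one_mul]
  refine le_antisymm hle ?_
  -- Split log|q_n F^*| into a sum and bound ∫ log|q_n| below by log|q_n(0)|. The right-hand side is
  -- arranged around q_n(0) F(0), which tends to 1.
  have hup (n : ℕ) : ∫ w, Real.log ‖boundary F w‖ ∂torusMeasure ≤ (1 / 4) ^ (n + 1) -
      Real.log ‖polyFun 1 (q n) ⟨0, zero_mem_polydisc⟩ * F ⟨0, zero_mem_polydisc⟩‖ +
      Real.log ‖F ⟨0, zero_mem_polydisc⟩‖ := by
    have hmul : ∀ᵐ w ∂torusMeasure, Real.log ‖torusPoly (q n) w‖ + Real.log ‖boundary F w‖ =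
        Real.log ‖torusPoly (q n) w * boundary F w‖ := by
      filter_upwards [hlim, (hJ n).1] with w h1 h2
      rw [norm_mul, Real.log_mul (norm_ne_zero_iff.2 h2) (norm_ne_zero_iff.2 h1.2)]
    have h1 := integral_log_le_of_nevanlinnaNorm_le hol (by positivity) (hq' n) hlim'
      (((hJ n).2.1.add hint).congr hmul) (by
        filter_upwards [hlim, (hJ n).1] with w h1 h2 using mul_ne_zero h2 h1.2)
    rw [← integral_congr_ae hmul, integral_add (hJ n).2.1 hint] at h1
    rw [norm_mul, Real.log_mul (norm_ne_zero_iff.2 (left_ne_zero_of_mul (hne n)))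
      (norm_ne_zero_iff.2 hF0)]
    linarith [(hJ n).2.2]
  have hprod : Tendsto (fun n => polyFun 1 (q n) ⟨0, zero_mem_polydisc⟩ *
      F ⟨0, zero_mem_polydisc⟩) atTop (𝓝 1) := by
    rw [tendsto_iff_norm_sub_tendsto_zero]
    refine squeeze_zero (fun _ => norm_nonneg _) (fun n => ?_)
      (htend (1 / 4) (by norm_num) (by norm_num))
    rw [norm_sub_rev]
    exact hz n
  have hlog : Tendsto (fun n => Real.log ‖polyFun 1 (q n) ⟨0, zero_mem_polydisc⟩ *
      F ⟨0, zero_mem_polydisc⟩‖) atTop (𝓝 0) := by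
    simpa using hprod.norm.log (by simp)
  have hpow : Tendsto (fun n : ℕ => (1 / 4 : ℝ) ^ (n + 1)) atTop (𝓝 0) :=
    (tendsto_pow_atTop_nhds_zero_of_lt_one (by norm_num) (by norm_num)).comp
      (tendsto_add_atTop_nat 1)
  have hfin := (hpow.sub hlog).add_const (Real.log ‖F ⟨0, zero_mem_polydisc⟩‖)
  rw [sub_zero, zero_add] at hfin
  exact ge_of_tendsto' hfin hup

end Outer

/-! ### Cyclic vectors and approximation of `1` -/

lemma exists_pos_mul_add_lt {K ε : ℝ≥0∞} (hK : K ≠ ∞) (hε : 0 < ε) :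
    ∃ δ : ℝ≥0∞, 0 < δ ∧ ∀ a < δ, ∀ b < δ, K * (a + b) < ε := by
  obtain ⟨δ, hδ, h⟩ := ENNReal.exists_nnreal_pos_mul_lt (ENNReal.mul_ne_top ENNReal.ofNat_ne_top hK :
    2 * K ≠ ∞) hε.ne'
  refine ⟨δ, by exact_mod_cast hδ, fun a ha b hb => lt_of_le_of_lt ?_ h⟩
  calc K * (a + b) ≤ K * (δ + δ) := by gcongr
    _ = δ * (2 * K) := by ring

/-- If `F` is cyclic, then `1` is a limit of multiples of `F` by polynomials. -/
theorem exists_lt_of_isCyclicIn {s : ℝ≥0∞} {X : Set (polydisc s → ℂ)}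
    {N : (polydisc s → ℂ) → ℝ≥0∞} {F : polydisc s → ℂ} (hF : IsCyclicIn X N F) (h1 : 1 ∈ X)
    (hadd : ∀ f ∈ X, ∀ g ∈ X, f + g ∈ X) (hmul : ∀ p, ∀ f ∈ X, polyFun s p * f ∈ X)
    (hN0 : N 0 = 0) {K : ℝ≥0∞} (hK : K ≠ ∞)
    (hNadd : ∀ f ∈ X, ∀ g ∈ X, N (f + g) ≤ K * (N f + N g))
    (hNmul : ∀ p, ∃ C : ℝ≥0∞, C ≠ ∞ ∧ ∀ f ∈ X, N (polyFun s p * f) ≤ C * N f)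
    {ε : ℝ≥0∞} (hε : 0 < ε) : ∃ p, N (1 - polyFun s p * F) < ε := by
  have hsub : ∀ f ∈ X, ∀ g ∈ X, f - g ∈ X := by
    intro f hf g hg
    have h : f - g = f + polyFun s (MvPolynomial.C (-1)) * g := by
      rw [polyFun_C]
      ext ζ
      simp [sub_eq_add_neg]
    rw [h]
    exact hadd f hf _ (hmul _ g hg)
  -- Serves twice: for invariance under polynomials and, with constant polynomials, for scalar
  -- multiples.
  have hmulS : ∀ r : MvPolynomial ℕ ℂ, ∀ G, (G ∈ X ∧ ∀ ε : ℝ≥0∞, 0 < ε →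
      ∃ p, N (G - polyFun s p * F) < ε) → (polyFun s r * G ∈ X ∧ ∀ ε : ℝ≥0∞, 0 < ε →
      ∃ p, N (polyFun s r * G - polyFun s p * F) < ε) := by
    rintro r G ⟨hG, hGa⟩
    refine ⟨hmul r G hG, fun ε hε => ?_⟩
    obtain ⟨C, hC, hCN⟩ := hNmul r
    obtain ⟨δ, hδ, h⟩ := exists_pos_mul_add_lt hC hε
    obtain ⟨p, hp⟩ := hGa δ hδ
    refine ⟨r * p, ?_⟩
    rw [polyFun_mul, mul_assoc, ← mul_sub]
    refine (hCN _ (hsub G hG _ (hmul p F hF.1))).trans_lt ?_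
    simpa using h _ hp 0 hδ
  -- S is the closure in X of the polynomial multiples of F. It is a closed invariant subspace
  -- containing F, so cyclicity puts 1 in it.
  let S : Submodule ℂ (polydisc s → ℂ) :=
    { carrier := {G | G ∈ X ∧ ∀ ε : ℝ≥0∞, 0 < ε → ∃ p, N (G - polyFun s p * F) < ε}
      zero_mem' := by
        have h0 : (0 : polydisc s → ℂ) = polyFun s (MvPolynomial.C 0) * F := by
          rw [polyFun_C]
          ext ζ
          simp
        refine ⟨by rw [h0]; exact hmul _ F hF.1, fun ε hε => ⟨MvPolynomial.C 0, ?_⟩⟩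
        rwa [← h0, sub_zero, hN0]
      add_mem' := by
        rintro G H ⟨hG, hGa⟩ ⟨hH, hHa⟩
        refine ⟨hadd G hG H hH, fun ε hε => ?_⟩
        obtain ⟨δ, hδ, h⟩ := exists_pos_mul_add_lt hK hε
        obtain ⟨p, hp⟩ := hGa δ hδ
        obtain ⟨r, hr⟩ := hHa δ hδ
        refine ⟨p + r, ?_⟩
        rw [polyFun_add, add_mul, add_sub_add_comm]
        exact (hNadd _ (hsub G hG _ (hmul p F hF.1)) _ (hsub H hH _ (hmul r F hF.1))).trans_lt
          (h _ hp _ hr)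
      smul_mem' := by
        intro c G hG
        have h : c • G = polyFun s (MvPolynomial.C c) * G := by
          rw [polyFun_C]
          ext ζ
          simp
        rw [h]
        exact hmulS _ G hG }
  have hS : IsClosedInvariant X N S := by
    refine ⟨fun G hG => hG.1, fun G hG hGa => ⟨hG, fun ε hε => ?_⟩, fun p G hG => hmulS p G hG⟩
    obtain ⟨δ, hδ, h⟩ := exists_pos_mul_add_lt hK hε
    obtain ⟨H, ⟨hH, hHa⟩, hGH⟩ := hGa δ hδ
    obtain ⟨p, hp⟩ := hHa δ hδ
    refine ⟨p, ?_⟩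
    rw [← sub_add_sub_cancel G H]
    exact (hNadd _ (hsub G hG H hH) _ (hsub H hH _ (hmul p F hF.1))).trans_lt (h _ hGH _ hp)
  have hFS : F ∈ S := ⟨hF.1, fun ε hε => ⟨1, by rwa [polyFun_one, one_mul, sub_self, hN0]⟩⟩
  have h1S : (1 : polydisc s → ℂ) ∈ (S : Set (polydisc s → ℂ)) := by rwa [hF.2 S hS hFS]
  exact h1S.2 ε hε

/-! ### The Smirnov class -/

section UniformIntegrability

variable {α ι : Type*} {m : MeasurableSpace α} {μ : Measure α} {f g : ι → α → ℝ}

lemma uniformIntegrable_mono (hf : UniformIntegrable f 1 μ)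
    (hg : ∀ i, AEStronglyMeasurable (g i) μ) (h : ∀ i x, ‖g i x‖ ≤ ‖f i x‖) :
    UniformIntegrable g 1 μ := by
  refine ⟨hg, fun ε hε => ?_, ?_⟩
  · obtain ⟨δ, hδ, hfδ⟩ := hf.2.1 hε
    refine ⟨δ, hδ, fun i s hs hμs => (eLpNorm_mono fun x => ?_).trans (hfδ i s hs hμs)⟩
    rw [norm_indicator_eq_indicator_norm, norm_indicator_eq_indicator_norm]
    exact Set.indicator_le_indicator (h i x)
  · obtain ⟨C, hC⟩ := hf.2.2
    exact ⟨C, fun i => (eLpNorm_mono (h i)).trans (hC i)⟩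

lemma uniformIntegrable_add (hf : UniformIntegrable f 1 μ) (hg : UniformIntegrable g 1 μ) :
    UniformIntegrable (f + g) 1 μ := by
  refine ⟨fun i => (hf.1 i).add (hg.1 i), hf.2.1.add hg.2.1 le_rfl hf.1 hg.1, ?_⟩
  obtain ⟨C, hC⟩ := hf.2.2
  obtain ⟨D, hD⟩ := hg.2.2
  refine ⟨C + D, fun i => (eLpNorm_add_le (hf.1 i) (hg.1 i) le_rfl).trans ?_⟩
  push_cast
  exact add_le_add (hC i) (hD i)

end UniformIntegrability

/-- `UniformIntegrable` includes a uniform L¹ bound, so the Nevanlinna condition comes for free. -/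
lemma mem_smirnovClass_iff {F : polydisc 1 → ℂ} : F ∈ smirnovClass ↔ IsHolomorphic F ∧
    UniformIntegrable (fun r w => Real.posLog ‖dilation F r w‖) 1 torusMeasure := by
  refine ⟨fun h => ⟨h.1.1, h.2⟩, fun h => ⟨⟨h.1, ?_⟩, h.2⟩⟩
  obtain ⟨C, hC⟩ := h.2.2.2
  refine lt_of_le_of_lt (iSup_le fun r => ?_) (ENNReal.coe_lt_top (r := C))
  refine le_trans (le_of_eq ?_) (hC r)
  rw [eLpNorm_one_eq_lintegral_enorm]
  congr 1 with w
  rw [Real.enorm_of_nonneg Real.posLog_nonneg]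

lemma aestronglyMeasurable_posLog_dilation {F : polydisc 1 → ℂ} (hF : IsHolomorphic F)
    (r : Set.Ioo (0 : ℝ) 1) :
    AEStronglyMeasurable (fun w => Real.posLog ‖dilation F r w‖) torusMeasure :=
  (Real.continuous_posLog.comp
    (hF.continuous_dilation ENNReal.one_ne_top r).norm).aestronglyMeasurable

lemma mem_smirnovClass_of_le {F : polydisc 1 → ℂ} (hF : IsHolomorphic F) {c : ℝ}
    {f : Set.Ioo (0 : ℝ) 1 → Torus → ℝ} (hf : UniformIntegrable f 1 torusMeasure)
    (h : ∀ r w, Real.posLog ‖dilation F r w‖ ≤ c + f r w) : F ∈ smirnovClass := by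
  refine mem_smirnovClass_iff.2 ⟨hF, uniformIntegrable_mono
    (uniformIntegrable_add (uniformIntegrable_const le_rfl ENNReal.one_ne_top
      (memLp_const c)) hf) (fun r => aestronglyMeasurable_posLog_dilation hF r) fun r w => ?_⟩
  rw [Real.norm_of_nonneg Real.posLog_nonneg]
  exact (h r w).trans (le_abs_self _)

lemma one_mem_smirnovClass : (1 : polydisc 1 → ℂ) ∈ smirnovClass := by
  refine mem_smirnovClass_of_le (c := 0) (f := fun _ _ => 0) (isHolomorphic_const 1)
    (uniformIntegrable_const le_rfl ENNReal.one_ne_top (memLp_const 0)) fun r w => ?_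
  simp [dilation]

lemma add_mem_smirnovClass {F G : polydisc 1 → ℂ} (hF : F ∈ smirnovClass)
    (hG : G ∈ smirnovClass) : F + G ∈ smirnovClass := by
  refine mem_smirnovClass_of_le (c := Real.log 2) (hF.1.1.add hG.1.1)
    (uniformIntegrable_add hF.2 hG.2) fun r w => ?_
  have h := Real.posLog_norm_add_le (dilation F r w) (dilation G r w)
  change Real.posLog ‖dilation F r w + dilation G r w‖ ≤ _ + (_ + _)
  linarith

lemma polyFun_mul_mem_smirnovClass (p : MvPolynomial ℕ ℂ) {F : polydisc 1 → ℂ}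
    (hF : F ∈ smirnovClass) : polyFun 1 p * F ∈ smirnovClass := by
  obtain ⟨M, hM⟩ := exists_norm_polyFun_le (s := 1) p
  refine mem_smirnovClass_of_le (c := Real.posLog M)
    ((isHolomorphic_polyFun p).mul hF.1.1) hF.2 fun r w => ?_
  change Real.posLog ‖dilation (polyFun 1 p) r w * dilation F r w‖ ≤ _
  rw [norm_mul]
  exact Real.posLog_mul.trans (add_le_add_left (Real.posLog_le_posLog (norm_nonneg _) (hM _)) _)

lemma nevanlinnaNorm_zero : nevanlinnaNorm 0 = 0 := by
  simp [nevanlinnaNorm, dilation]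

lemma nevanlinnaNorm_add_le {F G : polydisc 1 → ℂ} (hF : IsHolomorphic F) :
    nevanlinnaNorm (F + G) ≤ nevanlinnaNorm F + nevanlinnaNorm G := by
  refine iSup_le fun r => ?_
  calc _ ≤ ∫⁻ w, (ENNReal.ofReal (Real.log (1 + ‖dilation F r w‖)) +
        ENNReal.ofReal (Real.log (1 + ‖dilation G r w‖))) ∂torusMeasure := by
        refine lintegral_mono fun w => ?_
        rw [← ENNReal.ofReal_add (log_one_add_norm_nonneg _) (log_one_add_norm_nonneg _),
          ← Real.log_mul (by positivity) (by positivity)]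
        refine ENNReal.ofReal_le_ofReal (Real.log_le_log (by positivity) ?_)
        have h := norm_add_le (dilation F r w) (dilation G r w)
        change 1 + ‖dilation F r w + dilation G r w‖ ≤ _
        nlinarith [norm_nonneg (dilation F r w), norm_nonneg (dilation G r w)]
    _ = ∫⁻ w, ENNReal.ofReal (Real.log (1 + ‖dilation F r w‖)) ∂torusMeasure +
        ∫⁻ w, ENNReal.ofReal (Real.log (1 + ‖dilation G r w‖)) ∂torusMeasure :=
        lintegral_add_left (hF.measurable_log_dilation ENNReal.one_ne_top r) _
    _ ≤ _ := by
        refine add_le_add ?_ ?_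
        · exact le_iSup (fun r => ∫⁻ w, ENNReal.ofReal (Real.log (1 + ‖dilation F r w‖))
            ∂torusMeasure) r
        · exact le_iSup (fun r => ∫⁻ w, ENNReal.ofReal (Real.log (1 + ‖dilation G r w‖))
            ∂torusMeasure) r

/-- Bernoulli's inequality 1 + Mx ≤ (1 + x)^M. It makes up for the lack of homogeneity of ‖·‖_0 when
multiplying by a bounded function. -/
lemma log_one_add_mul_le {M x : ℝ} (hM : 1 ≤ M) (hx : 0 ≤ x) :
    Real.log (1 + M * x) ≤ M * Real.log (1 + x) := by
  rw [← Real.log_rpow (by positivity)]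
  exact Real.log_le_log (by positivity) (one_add_mul_self_le_rpow_one_add (by linarith) hM)

lemma exists_nevanlinnaNorm_polyFun_mul_le (p : MvPolynomial ℕ ℂ) :
    ∃ C : ℝ≥0∞, C ≠ ∞ ∧ ∀ F : polydisc 1 → ℂ,
      nevanlinnaNorm (polyFun 1 p * F) ≤ C * nevanlinnaNorm F := by
  obtain ⟨M, hM⟩ := exists_norm_polyFun_le (s := 1) p
  refine ⟨ENNReal.ofReal (max 1 M), ENNReal.ofReal_ne_top, fun F => iSup_le fun r => ?_⟩
  calc _ ≤ ∫⁻ w, ENNReal.ofReal (max 1 M) *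
        ENNReal.ofReal (Real.log (1 + ‖dilation F r w‖)) ∂torusMeasure := by
        refine lintegral_mono fun w => ?_
        rw [← ENNReal.ofReal_mul (by positivity)]
        refine ENNReal.ofReal_le_ofReal
          (le_trans ?_ (log_one_add_mul_le (le_max_left 1 M) (norm_nonneg _)))
        refine Real.log_le_log (by positivity) ?_
        change 1 + ‖polyFun 1 p (dilate 1 r w) * dilation F r w‖ ≤ _
        rw [norm_mul]
        gcongr
        exact (hM _).trans (le_max_right _ _)
    _ = ENNReal.ofReal (max 1 M) *
        ∫⁻ w, ENNReal.ofReal (Real.log (1 + ‖dilation F r w‖)) ∂torusMeasure :=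
        lintegral_const_mul' _ _ ENNReal.ofReal_ne_top
    _ ≤ _ := by
        gcongr
        exact le_iSup (fun r => ∫⁻ w, ENNReal.ofReal (Real.log (1 + ‖dilation F r w‖))
          ∂torusMeasure) r

/-- Cyclic vectors of the Smirnov class are outer. -/
theorem isOuter_of_isCyclicIn_smirnovClass {F : polydisc 1 → ℂ}
    (hF : IsCyclicIn smirnovClass nevanlinnaNorm F) : IsOuter F :=
  isOuter_of_forall_exists_nevanlinnaNorm_lt hF.1 fun _ hε =>
    exists_lt_of_isCyclicIn hF one_mem_smirnovClass (fun _ hf _ hg => add_mem_smirnovClass hf hg)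
      (fun p _ hf => polyFun_mul_mem_smirnovClass p hf) nevanlinnaNorm_zero ENNReal.one_ne_top
      (fun _ hf _ _ => by rw [one_mul]; exact nevanlinnaNorm_add_le hf.1.1)
      (fun p => (exists_nevanlinnaNorm_polyFun_mul_le p).imp fun _ h => ⟨h.1, fun F _ => h.2 F⟩) hε

/-! ### Hardy spaces -/

/-- Used with exponents p and 1/p, it gives a quasi-triangle inequality for all p > 0 at once,
without separating p < 1 from p ≥ 1. -/
lemma ennreal_add_rpow_le (a b : ℝ≥0∞) {t : ℝ} (ht : 0 ≤ t) :
    (a + b) ^ t ≤ 2 ^ t * (a ^ t + b ^ t) := by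
  calc (a + b) ^ t ≤ (2 * max a b) ^ t := by
        gcongr
        rw [two_mul]
        exact add_le_add (le_max_left _ _) (le_max_right _ _)
    _ = 2 ^ t * max (a ^ t) (b ^ t) := by
        rw [ENNReal.mul_rpow_of_nonneg _ _ ht, (ENNReal.monotone_rpow_of_nonneg ht).map_max]
    _ ≤ _ := by
        gcongr
        exact max_le le_self_add le_add_self

/-- The integral means in the definition of the Hardy spaces. -/
def hardyMean (p : ℝ) (F : polydisc 2 → ℂ) : ℝ≥0∞ :=
  ⨆ r, ∫⁻ w, ‖dilation F r w‖ₑ ^ p ∂torusMeasure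

lemma le_hardyMean (p : ℝ) (F : polydisc 2 → ℂ) (r : Set.Ioo (0 : ℝ) 1) :
    ∫⁻ w, ‖dilation F r w‖ₑ ^ p ∂torusMeasure ≤ hardyMean p F :=
  le_iSup (fun r => ∫⁻ w, ‖dilation F r w‖ₑ ^ p ∂torusMeasure) r

section Hardy

variable {p : ℝ} {F G : polydisc 2 → ℂ}

lemma hardyNorm_eq : hardyNorm p F = hardyMean p F ^ (1 / p) := rfl

lemma hardyMean_lt_top (hp : 0 < p) (hF : F ∈ hardySpace p) : hardyMean p F < ∞ := by
  have h := hF.2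
  rwa [hardyNorm_eq, ENNReal.rpow_lt_top_iff_of_pos (by positivity)] at h

lemma hardyMean_add_le (hp : 0 < p) (hF : IsHolomorphic F) :
    hardyMean p (F + G) ≤ 2 ^ p * (hardyMean p F + hardyMean p G) := by
  refine iSup_le fun r => ?_
  have hm : Measurable fun w => ‖dilation F r w‖ₑ ^ p :=
    ((hF.continuous_dilation ENNReal.ofNat_ne_top r).enorm.measurable).pow_const p
  calc _ ≤ ∫⁻ w, 2 ^ p * (‖dilation F r w‖ₑ ^ p + ‖dilation G r w‖ₑ ^ p) ∂torusMeasure := by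
        refine lintegral_mono fun w => ?_
        refine le_trans ?_ (ennreal_add_rpow_le _ _ hp.le)
        gcongr
        exact enorm_add_le (dilation F r w) (dilation G r w)
    _ = 2 ^ p * (∫⁻ w, ‖dilation F r w‖ₑ ^ p ∂torusMeasure +
        ∫⁻ w, ‖dilation G r w‖ₑ ^ p ∂torusMeasure) := by
        rw [lintegral_const_mul' _ _ (ENNReal.rpow_ne_top_of_nonneg hp.le (by norm_num)),
          lintegral_add_left hm]
    _ ≤ _ := by
        gcongr
        · exact le_hardyMean p F r
        · exact le_hardyMean p G r

lemma hardyNorm_add_le (hp : 0 < p) (hF : IsHolomorphic F) :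
    hardyNorm p (F + G) ≤ (2 * 2 ^ (1 / p)) * (hardyNorm p F + hardyNorm p G) := by
  simp only [hardyNorm_eq]
  calc _ ≤ (2 ^ p * (hardyMean p F + hardyMean p G)) ^ (1 / p) := by
        gcongr
        exact hardyMean_add_le hp hF
    _ = 2 * (hardyMean p F + hardyMean p G) ^ (1 / p) := by
        rw [ENNReal.mul_rpow_of_nonneg _ _ (by positivity), ← ENNReal.rpow_mul,
          mul_one_div_cancel hp.ne', ENNReal.rpow_one]
    _ ≤ 2 * (2 ^ (1 / p) * (hardyMean p F ^ (1 / p) + hardyMean p G ^ (1 / p))) := by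
        gcongr
        exact ennreal_add_rpow_le _ _ (by positivity)
    _ = _ := by ring

lemma hardyNorm_zero (hp : 0 < p) : hardyNorm p 0 = 0 := by
  simp [hardyNorm, dilation, hp]

lemma exists_hardyNorm_polyFun_mul_le (hp : 0 < p) (q : MvPolynomial ℕ ℂ) :
    ∃ C : ℝ≥0∞, C ≠ ∞ ∧ ∀ F : polydisc 2 → ℂ,
      hardyNorm p (polyFun 2 q * F) ≤ C * hardyNorm p F := by
  obtain ⟨M, hM⟩ := exists_norm_polyFun_le (s := 2) q
  refine ⟨ENNReal.ofReal M, ENNReal.ofReal_ne_top, fun F => ?_⟩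
  have hmean : hardyMean p (polyFun 2 q * F) ≤ ENNReal.ofReal M ^ p * hardyMean p F := by
    refine iSup_le fun r => ?_
    calc _ ≤ ∫⁻ w, ENNReal.ofReal M ^ p * ‖dilation F r w‖ₑ ^ p ∂torusMeasure := by
          refine lintegral_mono fun w => ?_
          rw [← ENNReal.mul_rpow_of_nonneg _ _ hp.le]
          gcongr
          change ‖polyFun 2 q (dilate 2 r w) * dilation F r w‖ₑ ≤ _
          rw [enorm_mul, ← ofReal_norm]
          gcongr
          exact hM _
      _ = ENNReal.ofReal M ^ p * ∫⁻ w, ‖dilation F r w‖ₑ ^ p ∂torusMeasure :=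
          lintegral_const_mul' _ _ (ENNReal.rpow_ne_top_of_nonneg hp.le ENNReal.ofReal_ne_top)
      _ ≤ _ := by
          gcongr
          exact le_hardyMean p F r
  simp only [hardyNorm_eq]
  calc _ ≤ (ENNReal.ofReal M ^ p * hardyMean p F) ^ (1 / p) := by gcongr
    _ = _ := by
      rw [ENNReal.mul_rpow_of_nonneg _ _ (by positivity), ← ENNReal.rpow_mul,
        mul_one_div_cancel hp.ne', ENNReal.rpow_one]

lemma one_mem_hardySpace (hp : 0 < p) : (1 : polydisc 2 → ℂ) ∈ hardySpace p := by
  refine ⟨isHolomorphic_const 1, ?_⟩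
  rw [hardyNorm_eq, ENNReal.rpow_lt_top_iff_of_pos (by positivity)]
  refine (iSup_le fun r => ?_).trans_lt ENNReal.one_lt_top
  simp [dilation]

lemma add_mem_hardySpace (hp : 0 < p) (hF : F ∈ hardySpace p) (hG : G ∈ hardySpace p) :
    F + G ∈ hardySpace p := by
  refine ⟨hF.1.add hG.1, (hardyNorm_add_le hp hF.1).trans_lt ?_⟩
  refine ENNReal.mul_lt_top (ENNReal.mul_lt_top (by norm_num) ?_) (ENNReal.add_lt_top.2 ⟨hF.2, hG.2⟩)
  exact ENNReal.rpow_lt_top_of_nonneg (by positivity) (by norm_num)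

lemma polyFun_mul_mem_hardySpace (hp : 0 < p) (q : MvPolynomial ℕ ℂ) (hF : F ∈ hardySpace p) :
    polyFun 2 q * F ∈ hardySpace p := by
  obtain ⟨C, hC, h⟩ := exists_hardyNorm_polyFun_mul_le hp q
  exact ⟨(isHolomorphic_polyFun q).mul hF.1,
    (h F).trans_lt (ENNReal.mul_lt_top hC.lt_top hF.2)⟩

/-! ### Restriction from 𝔻_2^∞ to 𝔻_1^∞ -/

lemma sum_sq_le_sq_sum {ι : Type*} (S : Finset ι) {f : ι → ℝ} (hf : ∀ i, 0 ≤ f i) :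
    ∑ i ∈ S, f i ^ 2 ≤ (∑ i ∈ S, f i) ^ 2 := by
  rw [sq (∑ i ∈ S, f i), Finset.sum_mul]
  refine Finset.sum_le_sum fun i hi => ?_
  rw [sq]
  exact mul_le_mul_of_nonneg_left (Finset.single_le_sum (fun j _ => hf j) hi) (hf i)

/-- The inclusion of `ℓ^1` in `ℓ^2`. -/
def lpIncl (x : lp (fun _ : ℕ => ℂ) 1) : lp (fun _ : ℕ => ℂ) 2 :=
  ⟨fun n => x n, (lp.memℓp x).of_exponent_ge one_le_two⟩

lemma norm_lpIncl_le (x : lp (fun _ : ℕ => ℂ) 1) : ‖lpIncl x‖ ≤ ‖x‖ := by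
  refine lp.norm_le_of_forall_sum_le (by norm_num) (norm_nonneg x) fun S => ?_
  have h1 : ∑ i ∈ S, ‖x i‖ ≤ ‖x‖ := by
    simpa using lp.sum_rpow_le_norm_rpow (p := 1) (by norm_num) x S
  calc ∑ i ∈ S, ‖lpIncl x i‖ ^ (2 : ℝ≥0∞).toReal = ∑ i ∈ S, ‖x i‖ ^ 2 := by
        refine Finset.sum_congr rfl fun i _ => ?_
        simp [lpIncl]
    _ ≤ (∑ i ∈ S, ‖x i‖) ^ 2 := sum_sq_le_sq_sum S fun i => norm_nonneg (x i)
    _ ≤ ‖x‖ ^ 2 := by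
        have := Finset.sum_nonneg fun i (_ : i ∈ S) => norm_nonneg (x i)
        gcongr
    _ = _ := by simp

lemma lpIncl_apply (x : lp (fun _ : ℕ => ℂ) 1) (n : ℕ) : lpIncl x n = x n := rfl

lemma lpIncl_sub (x y : lp (fun _ : ℕ => ℂ) 1) : lpIncl (x - y) = lpIncl x - lpIncl y := by
  ext n
  simp only [lpIncl_apply, lp.coeFn_sub, Pi.sub_apply]

lemma lpIncl_add_smul (x y : lp (fun _ : ℕ => ℂ) 1) (z : ℂ) :
    lpIncl (x + z • y) = lpIncl x + z • lpIncl y := by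
  ext n
  simp only [lpIncl_apply, lp.coeFn_add, lp.coeFn_smul, Pi.add_apply, Pi.smul_apply]

lemma continuous_lpIncl : Continuous lpIncl := by
  refine LipschitzWith.continuous (K := 1) (LipschitzWith.of_dist_le_mul fun x y => ?_)
  rw [dist_eq_norm, dist_eq_norm, NNReal.coe_one, one_mul, ← lpIncl_sub]
  exact norm_lpIncl_le (x - y)

lemma lpIncl_mem_polydisc {x : lp (fun _ : ℕ => ℂ) 1} (hx : x ∈ polydisc 1) :
    lpIncl x ∈ polydisc 2 := fun n => by
  rw [lpIncl_apply]
  exact hx n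

lemma incl_eq {x : lp (fun _ : ℕ => ℂ) 1} (hx : x ∈ polydisc 1) :
    incl ⟨x, hx⟩ = ⟨lpIncl x, lpIncl_mem_polydisc hx⟩ := by
  refine Subtype.ext (lp.ext (funext fun n => ?_))
  rfl

lemma continuous_incl : Continuous incl := by
  have h : incl = fun x => ⟨lpIncl x, lpIncl_mem_polydisc x.2⟩ := funext fun x => incl_eq x.2
  rw [h]
  exact Continuous.subtype_mk (continuous_lpIncl.comp continuous_subtype_val) _

lemma IsHolomorphic.comp_incl (hF : IsHolomorphic F) : IsHolomorphic (F ∘ incl) := by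
  refine .of_forall (fun x => ?_) fun x₀ h₀ x =>
    ⟨fun z => Function.extend Subtype.val F 0 (lpIncl x₀ + z • lpIncl x), ?_, ?_⟩
  · obtain ⟨M, hM⟩ := hF.1 (incl x)
    exact ⟨M, continuous_incl.continuousAt.eventually hM⟩
  · refine (hF.2 (lpIncl x₀) (lpIncl_mem_polydisc h₀) (lpIncl x)).mono fun z hz => ?_
    rw [Set.mem_ofPred_eq, ← lpIncl_add_smul]
    exact lpIncl_mem_polydisc hz
  · intro z hz
    beta_reduce
    rw [← lpIncl_add_smul, extend_val_of_mem F (lpIncl_mem_polydisc hz), ← incl_eq hz,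
      Function.comp_apply]

lemma incl_dilate (r : Set.Ioo (0 : ℝ) 1) (w : Torus) : incl (dilate 1 r w) = dilate 2 r w :=
  Subtype.ext (lp.ext (funext fun _ => rfl))

lemma dilation_comp_incl (F : polydisc 2 → ℂ) (r : Set.Ioo (0 : ℝ) 1) (w : Torus) :
    dilation (F ∘ incl) r w = dilation F r w := by
  rw [dilation, dilation, Function.comp_apply, incl_dilate]

lemma polyFun_comp_incl (q : MvPolynomial ℕ ℂ) : polyFun 2 q ∘ incl = polyFun 1 q := rfl

/-! ### Comparison of Hardy and Nevanlinna means -/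

/-- Half of the power x^p dominates log x, and on log x ≥ c the other half is at least e^{cp/2}. The
gain e^{-cp/2} makes the tails of log⁺|F_[r]| uniformly small. -/
lemma posLog_le_of_le_posLog {c x : ℝ} (hp : 0 < p) (hx : 0 ≤ x) (hc : 0 < c)
    (h : c ≤ Real.posLog x) :
    Real.posLog x ≤ 2 / p * Real.exp (-(c * (p / 2))) * x ^ p := by
  have h1 : 1 < x := by
    by_contra hcon
    rw [(Real.posLog_eq_zero_iff x).2 (by rw [abs_of_nonneg hx]; exact not_lt.1 hcon)] at h
    linarith
  have hx0 : 0 < x := by linarith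
  rw [Real.posLog_eq_log (by rw [abs_of_nonneg hx]; exact h1.le)] at h ⊢
  have h2 : Real.log x ≤ x ^ (p / 2) / (p / 2) := Real.log_le_rpow_div hx (by positivity)
  have h3 : Real.exp (c * (p / 2)) ≤ x ^ (p / 2) := by
    rw [Real.rpow_def_of_pos hx0]
    gcongr
  have h4 : x ^ (p / 2) ≤ Real.exp (-(c * (p / 2))) * x ^ p := by
    have h5 : x ^ p = x ^ (p / 2) * x ^ (p / 2) := by
      rw [← Real.rpow_add hx0]
      ring_nf
    rw [Real.exp_neg, h5, ← div_eq_inv_mul, le_div_iff₀ (Real.exp_pos _)]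
    gcongr
  calc Real.log x ≤ x ^ (p / 2) / (p / 2) := h2
    _ = 2 / p * x ^ (p / 2) := by field_simp
    _ ≤ 2 / p * (Real.exp (-(c * (p / 2))) * x ^ p) := by gcongr
    _ = _ := by ring

/-- The Hardy spaces are contained in the Smirnov class. -/
lemma comp_incl_mem_smirnovClass (hp : 0 < p) (hF : F ∈ hardySpace p) :
    F ∘ incl ∈ smirnovClass := by
  have hol := hF.1.comp_incl
  refine mem_smirnovClass_iff.2 ⟨hol, uniformIntegrable_of le_rfl ENNReal.one_ne_top
    (fun r => aestronglyMeasurable_posLog_dilation hol r) fun ε hε => ?_⟩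
  set B := (hardyMean p F).toReal with hB
  have hBF : hardyMean p F = ENNReal.ofReal B :=
    (ENNReal.ofReal_toReal (hardyMean_lt_top hp hF).ne).symm
  have hB0 : 0 ≤ B := ENNReal.toReal_nonneg
  obtain ⟨c, hc0, hc⟩ : ∃ c : ℝ, 0 < c ∧ 2 / p * Real.exp (-(c * (p / 2))) * B ≤ ε := by
    have h : Tendsto (fun c : ℝ => 2 / p * Real.exp (-(c * (p / 2))) * B) atTop
        (𝓝 (2 / p * 0 * B)) :=
      ((Real.tendsto_exp_neg_atTop_nhds_zero.comp
        (tendsto_id.atTop_mul_const (by positivity : 0 < p / 2))).const_mul _).mul_const _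
    rw [mul_zero, zero_mul] at h
    obtain ⟨c, h1, h2⟩ := ((h.eventually (gt_mem_nhds hε)).and (eventually_gt_atTop 0)).exists
    exact ⟨c, h2, h1.le⟩
  refine ⟨⟨c, hc0.le⟩, fun r => ?_⟩
  rw [eLpNorm_one_eq_lintegral_enorm]
  have hpt (w : Torus) : ‖({x | (⟨c, hc0.le⟩ : NNReal) ≤ ‖Real.posLog ‖dilation (F ∘ incl) r x‖‖₊}.indicator
      (fun w => Real.posLog ‖dilation (F ∘ incl) r w‖) w)‖ₑ ≤
      ENNReal.ofReal (2 / p * Real.exp (-(c * (p / 2)))) * ‖dilation F r w‖ₑ ^ p := by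
    simp only [dilation_comp_incl]
    by_cases hw : (⟨c, hc0.le⟩ : NNReal) ≤ ‖Real.posLog ‖dilation F r w‖‖₊
    · rw [Set.indicator_of_mem (by exact hw), Real.enorm_of_nonneg Real.posLog_nonneg,
        ← ofReal_norm, ENNReal.ofReal_rpow_of_nonneg (norm_nonneg _) hp.le,
        ← ENNReal.ofReal_mul (by positivity)]
      refine ENNReal.ofReal_le_ofReal (posLog_le_of_le_posLog hp (norm_nonneg _) hc0 ?_)
      have h := NNReal.coe_le_coe.2 hw
      rwa [coe_nnnorm, Real.norm_of_nonneg Real.posLog_nonneg] at h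
    · rw [Set.indicator_of_notMem (by exact hw)]
      simp
  calc _ ≤ ∫⁻ w, ENNReal.ofReal (2 / p * Real.exp (-(c * (p / 2)))) * ‖dilation F r w‖ₑ ^ p
        ∂torusMeasure := lintegral_mono hpt
    _ = ENNReal.ofReal (2 / p * Real.exp (-(c * (p / 2)))) *
        ∫⁻ w, ‖dilation F r w‖ₑ ^ p ∂torusMeasure :=
        lintegral_const_mul' _ _ ENNReal.ofReal_ne_top
    _ ≤ ENNReal.ofReal (2 / p * Real.exp (-(c * (p / 2)))) * ENNReal.ofReal B := by
        gcongr
        rw [← hBF]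
        exact le_hardyMean p F r
    _ ≤ ENNReal.ofReal ε := by
        rw [← ENNReal.ofReal_mul (by positivity)]
        exact ENNReal.ofReal_le_ofReal hc

/-- For p > 1 no multiple of x^p dominates log(1+x) near 0, hence the additive η for x ≤ η; beyond
η, 1 + x is at most a multiple of x. -/
lemma log_one_add_le_add_rpow {η x : ℝ} (hp : 0 < p) (hη : 0 < η) (hx : 0 ≤ x) :
    Real.log (1 + x) ≤ η + (1 / η + 1) ^ p / p * x ^ p := by
  rcases le_or_gt x η with h | h
  · have h1 := Real.log_le_sub_one_of_pos (show 0 < 1 + x by linarith)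
    have h2 : 0 ≤ (1 / η + 1) ^ p / p * x ^ p := by positivity
    linarith
  · have h1 : Real.log (1 + x) ≤ (1 + x) ^ p / p := Real.log_le_rpow_div (by linarith) hp
    have h2 : 1 + x ≤ (1 / η + 1) * x := by
      have : 1 ≤ 1 / η * x := by rw [one_div_mul_eq_div, one_le_div hη]; exact h.le
      linarith
    calc _ ≤ (1 + x) ^ p / p := h1
      _ ≤ ((1 / η + 1) * x) ^ p / p := by gcongr
      _ = (1 / η + 1) ^ p / p * x ^ p := by
        rw [Real.mul_rpow (by positivity) hx]
        ring
      _ ≤ _ := by linarith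

lemma nevanlinnaNorm_comp_incl_le (hp : 0 < p) {η : ℝ} (hη : 0 < η) (F : polydisc 2 → ℂ) :
    nevanlinnaNorm (F ∘ incl) ≤
      ENNReal.ofReal η + ENNReal.ofReal ((1 / η + 1) ^ p / p) * hardyMean p F := by
  refine iSup_le fun r => ?_
  calc _ ≤ ∫⁻ w, (ENNReal.ofReal η + ENNReal.ofReal ((1 / η + 1) ^ p / p) *
        ‖dilation F r w‖ₑ ^ p) ∂torusMeasure := by
        refine lintegral_mono fun w => ?_
        rw [dilation_comp_incl, ← ofReal_norm (dilation F r w), ENNReal.ofReal_rpow_of_nonneg (norm_nonneg _) hp.le,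
          ← ENNReal.ofReal_mul (by positivity), ← ENNReal.ofReal_add hη.le (by positivity)]
        exact ENNReal.ofReal_le_ofReal (log_one_add_le_add_rpow hp hη (norm_nonneg _))
    _ = ENNReal.ofReal η + ENNReal.ofReal ((1 / η + 1) ^ p / p) *
        ∫⁻ w, ‖dilation F r w‖ₑ ^ p ∂torusMeasure := by
        rw [lintegral_add_left measurable_const, lintegral_const_mul' _ _ ENNReal.ofReal_ne_top]
        simp
    _ ≤ _ := by
        gcongr
        exact le_hardyMean p F r

lemma exists_nevanlinnaNorm_lt_of_hardyNorm_lt (hp : 0 < p) {ε : ℝ≥0∞} (hε : 0 < ε) :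
    ∃ δ : ℝ≥0∞, 0 < δ ∧ ∀ F : polydisc 2 → ℂ, hardyNorm p F < δ → nevanlinnaNorm (F ∘ incl) < ε := by
  have hε2 : ε / 2 ≠ 0 := (ENNReal.half_pos hε.ne').ne'
  -- η is fixed first, as the factor of the Hardy mean blows up when η → 0; t is then chosen against
  -- that factor.
  obtain ⟨η, hη, hηε⟩ := ENNReal.exists_nnreal_pos_mul_lt ENNReal.one_ne_top hε2
  obtain ⟨t, ht, htε⟩ := ENNReal.exists_nnreal_pos_mul_lt
    (ENNReal.ofReal_ne_top (r := (1 / (η : ℝ) + 1) ^ p / p)) hε2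
  refine ⟨(t : ℝ≥0∞) ^ (1 / p), ENNReal.rpow_pos (by exact_mod_cast ht) ENNReal.coe_ne_top,
    fun F hF => ?_⟩
  rw [hardyNorm_eq, ENNReal.rpow_lt_rpow_iff (by positivity)] at hF
  refine (nevanlinnaNorm_comp_incl_le hp (NNReal.coe_pos.2 hη) F).trans_lt ?_
  rw [ENNReal.ofReal_coe_nnreal]
  calc _ ≤ (η : ℝ≥0∞) * 1 + t * ENNReal.ofReal ((1 / (η : ℝ) + 1) ^ p / p) := by
        rw [mul_one, mul_comm (t : ℝ≥0∞)]
        gcongr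
    _ < ε / 2 + ε / 2 := ENNReal.add_lt_add hηε htε
    _ = ε := ENNReal.add_halves ε

/-- The restrictions to `𝔻_1^∞` of cyclic vectors of the Hardy spaces are outer. -/
theorem isOuter_of_isCyclicIn_hardySpace (hp : 0 < p)
    (hF : IsCyclicIn (hardySpace p) (hardyNorm p) F) : IsOuter (F ∘ incl) := by
  refine isOuter_of_forall_exists_nevanlinnaNorm_lt (comp_incl_mem_smirnovClass hp hF.1)
    fun ε hε => ?_
  obtain ⟨δ, hδ, h⟩ := exists_nevanlinnaNorm_lt_of_hardyNorm_lt hp hε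
  obtain ⟨q, hq⟩ := exists_lt_of_isCyclicIn hF (one_mem_hardySpace hp)
    (fun _ hf _ hg => add_mem_hardySpace hp hf hg) (fun q _ hf => polyFun_mul_mem_hardySpace hp q hf)
    (hardyNorm_zero hp) (K := 2 * 2 ^ (1 / p))
    (ENNReal.mul_ne_top (by norm_num) (ENNReal.rpow_ne_top_of_nonneg (by positivity) (by norm_num)))
    (fun _ hf _ _ => hardyNorm_add_le hp hf.1)
    (fun q => (exists_hardyNorm_polyFun_mul_le hp q).imp fun _ h => ⟨h.1, fun F _ => h.2 F⟩) hδ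
  refine ⟨q, ?_⟩
  have h1 := h _ hq
  have h2 : (1 - polyFun 2 q * F) ∘ incl = 1 - polyFun 1 q * (F ∘ incl) := by
    rw [← polyFun_comp_incl]
    rfl
  rwa [h2] at h1

end Hardy

end InfinitePolydisc

end

theorem theorem2p18 :
    (∀ F : InfinitePolydisc.polydisc 1 → ℂ,
      InfinitePolydisc.IsCyclicIn InfinitePolydisc.smirnovClass InfinitePolydisc.nevanlinnaNorm F →
        InfinitePolydisc.IsOuter F) ∧
    (∀ p : ℝ, 0 < p → ∀ F : InfinitePolydisc.polydisc 2 → ℂ,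
      InfinitePolydisc.IsCyclicIn (InfinitePolydisc.hardySpace p) (InfinitePolydisc.hardyNorm p) F →
        InfinitePolydisc.IsOuter (F ∘ InfinitePolydisc.incl)) := by
  exact ⟨fun _ hF => InfinitePolydisc.isOuter_of_isCyclicIn_smirnovClass hF,
    fun _ hp _ hF => InfinitePolydisc.isOuter_of_isCyclicIn_hardySpace hp hF⟩
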